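/- All graphs are finite and simple. A graph is a proper interval graph (respectively a proper circular-arc graph, PCA) if it is isomorphic to the intersection graph of a family of pairwise inclusion-incomparable intervals of some segment $\{1,\dots,m\}$ (respectively arcs of some directed cycle $\mathbb Z_m$, $m\ge 1$); two distinct members of the family are adjacent in its intersection graph iff they intersect, and the empty interval and empty arc are allowed. For a graph $G$ with $n$ vertices, let $N[v]$ be the closed neighborhood of $v$ and let $\mathcal N[G]=\{N[v]\}_{v\in V(G)}$ be the closed neighborhood hypergraph on the vertex set $V(G)$. An interval representation of $\mathcal N[G]$ is a bijection $\lambda:V(G)\to\{1,\dots,n\}$ such that every $\lambda(N[v])$ is an interval; an arc representation is a bijection $\lambda:V(G)\to\mathbb Z_n$ such that every $\lambda(N[v])$ is an arc, i.e. a set of cyclically consecutive points. Two vertices are twins if every hyperedge of $\mathcal N[G]$ contains both or neither of them; a permutation of twins is a composition of bijections of $V(G)$ each of which fixes every vertex except possibly a pair of twins. The symmetries of $\{1,\dots,n\}$ are the identity and the reflection $x\mapsto n+1-x$; the symmetries of $\mathbb Z_n$ are the maps $x\mapsto \pm x+s$. Two representations $\lambda,\lambda'$ are equivalent up to congruence and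 permutation of twins if $\lambda'=\sigma\circ\lambda\circ\pi$ for some symmetry $\sigma$ and some permutation of twins $\pi$. Let $G$ be a connected (in particular nonempty) graph. 1. If $G$ is a proper interval graph, then $\mathcal N[G]$ has an interval representation, and any two interval representations of $\mathcal N[G]$ are equivalent up to congruence and permutation of twins. 2. If $G$ is a PCA graph whose complement is not bipartite, then $\mathcal N[G]$ has an arc representation, and any two arc representations of $\mathcal N[G]$ are equivalent up to congruence and permutation of twins. -/

import Mathlib

/-! ### Hypergraphs attached to graphs -/

/-- The closed neighborhood hypergraph `N[G]`: its vertices are those of `G`, its hyperedges are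
the closed neighborhoods `N[v] = {v} ∪ N(v)`. -/
def closedNeighborhoodHypergraph {V : Type*} (G : SimpleGraph V) : Hypergraph V where
  vertexSet := Set.univ
  edgeSet := Set.range fun v => insert v (G.neighborSet v)
  subset_vertexSet_of_mem_edgeSet' := fun _ _ => Set.subset_univ _

/-- The intersection graph of a hypergraph: the vertices are the hyperedges, and two distinct
hyperedges are adjacent when they have a common point. -/
def intersectionGraph {α : Type*} (H : Hypergraph α) : SimpleGraph H.edgeSet where
  Adj A B := A ≠ B ∧ ((A : Set α) ∩ (B : Set α)).Nonempty
  symm := ⟨fun _ _ h => ⟨h.1.symm, by rw [Set.inter_comm]; exact h.2⟩⟩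
  loopless := ⟨fun _ h => h.1 rfl⟩

/-- A hypergraph is proper when its hyperedges are pairwise incomparable by inclusion. -/
def IsProperHypergraph {α : Type*} (H : Hypergraph α) : Prop :=
  IsAntichain (fun A B : Set α => A ⊆ B) H.edgeSet

/-! ### Interval systems and arc systems -/

/-- The intervals of a segment of `n` consecutive integers (modelled by `Fin n`),
the empty one included. -/
def IsInterval {n : ℕ} (A : Set (Fin n)) : Prop :=
  A = ∅ ∨ ∃ a b : Fin n, A = Set.Icc a b

/-- The arc `[a, b]` of the circle `ZMod n` (`n ≠ 0`), whose successor map is `x ↦ x + 1`: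
the points of the directed path from `a` to `b`. -/
def circleArc {n : ℕ} (a b : ZMod n) : Set (ZMod n) :=
  {x | (x - a).val ≤ (b - a).val}

/-- The arcs of the circle `ZMod n`, the empty one included. -/
def IsArc {n : ℕ} (A : Set (ZMod n)) : Prop :=
  A = ∅ ∨ ∃ a b : ZMod n, A = circleArc a b

/-- An interval system: the vertex set is the whole segment, the hyperedges are intervals. -/
def IsIntervalSystem {n : ℕ} (I : Hypergraph (Fin n)) : Prop :=
  I.vertexSet = Set.univ ∧ ∀ A ∈ I.edgeSet, IsInterval A

/-- An arc system: the vertex set is a whole circle `ZMod n`, with `n ≥ 1` points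
(in Mathlib `ZMod 0` is `ℤ`, which is not a circle), and the hyperedges are arcs. -/
def IsArcSystem {n : ℕ} (A : Hypergraph (ZMod n)) : Prop :=
  n ≠ 0 ∧ A.vertexSet = Set.univ ∧ ∀ B ∈ A.edgeSet, IsArc B

/-! ### Proper interval graphs and proper circular-arc graphs -/

/-- A proper interval graph: isomorphic to the intersection graph of a proper interval system. -/
def IsProperIntervalGraph {V : Type*} (G : SimpleGraph V) : Prop :=
  ∃ (n : ℕ) (I : Hypergraph (Fin n)),
    IsIntervalSystem I ∧ IsProperHypergraph I ∧ Nonempty (G ≃g intersectionGraph I)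

/-- A proper circular-arc (PCA) graph: isomorphic to the intersection graph of a proper
arc system. -/
def IsProperCircularArcGraph {V : Type*} (G : SimpleGraph V) : Prop :=
  ∃ (n : ℕ) (A : Hypergraph (ZMod n)),
    IsArcSystem A ∧ IsProperHypergraph A ∧ Nonempty (G ≃g intersectionGraph A)

/-! ### Representations of hypergraphs -/

/-- `lam` is an interval representation of `H`: it is an isomorphism from `H` to an interval
system, which is then the image hypergraph. -/
def IsIntervalRepresentation {V : Type*} {n : ℕ} (H : Hypergraph V) (lam : V ≃ Fin n) : Prop :=
  IsIntervalSystem (H.image lam)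

/-- `lam` is an arc representation of `H`: it is an isomorphism from `H` to an arc system,
which is then the image hypergraph. -/
def IsArcRepresentation {V : Type*} {n : ℕ} (H : Hypergraph V) (lam : V ≃ ZMod n) : Prop :=
  IsArcSystem (H.image lam)

/-! ### Twins and symmetries -/

/-- Two vertices are twins in `H` when every hyperedge contains both or none of them. -/
def AreTwins {V : Type*} (H : Hypergraph V) (u v : V) : Prop :=
  ∀ A ∈ H.edgeSet, u ∈ A ↔ v ∈ A

/-- A transposition of twins: a bijection fixing each vertex except, possibly, a pair of twins. -/
def IsTwinTransposition {V : Type*} (H : Hypergraph V) (τ : Equiv.Perm V) : Prop :=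
  ∃ u v : V, AreTwins H u v ∧ ∀ w : V, w ≠ u → w ≠ v → τ w = w

/-- A permutation of twins: any composition of transpositions of twins. -/
def IsTwinPermutation {V : Type*} (H : Hypergraph V) (π : Equiv.Perm V) : Prop :=
  π ∈ Submonoid.closure {τ : Equiv.Perm V | IsTwinTransposition H τ}

/-- The symmetries of the segment: the identity and the reflection. -/
def IsSegmentSymmetry {n : ℕ} (σ : Equiv.Perm (Fin n)) : Prop :=
  (∀ x, σ x = x) ∨ ∀ x, σ x = Fin.rev x

/-- The symmetries of the circle: the rotations, and the reflection `x ↦ -x` followed by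
a rotation. -/
def IsCircleSymmetry {n : ℕ} (σ : Equiv.Perm (ZMod n)) : Prop :=
  ∃ s : ZMod n, (∀ x, σ x = x + s) ∨ ∀ x, σ x = -x + s

/-- Two interval representations are equivalent up to congruence and permutation of twins:
`lam' = σ ∘ lam ∘ π` for a symmetry `σ` of the segment and a permutation `π` of twins. -/
def IntervalEquivalent {V : Type*} {n : ℕ} (H : Hypergraph V) (lam lam' : V ≃ Fin n) : Prop :=
  ∃ (σ : Equiv.Perm (Fin n)) (π : Equiv.Perm V),
    IsSegmentSymmetry σ ∧ IsTwinPermutation H π ∧ ∀ v, lam' v = σ (lam (π v))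

/-- Two arc representations are equivalent up to congruence and permutation of twins:
`lam' = σ ∘ lam ∘ π` for a symmetry `σ` of the circle and a permutation `π` of twins. -/
def ArcEquivalent {V : Type*} {n : ℕ} (H : Hypergraph V) (lam lam' : V ≃ ZMod n) : Prop :=
  ∃ (σ : Equiv.Perm (ZMod n)) (π : Equiv.Perm V),
    IsCircleSymmetry σ ∧ IsTwinPermutation H π ∧ ∀ v, lam' v = σ (lam (π v))

/-! Existence: sort the vertices by the left endpoints of a proper model. No member contains
another, so the right endpoints come in the same order, and the members meeting a given one are
consecutive. Arcs are first lifted to integer intervals and continued periodically.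

Uniqueness for intervals: the closed neighborhoods being intervals, an edge makes all vertices under
it adjacent to both its ends, and connectedness makes consecutive vertices adjacent. The first
vertex of one order is a twin of an end vertex of any other (`IsUmbrella.first_twin_end`); after a
possible reflection the two orders agree position by position up to twins
(`IsUmbrella.twin_of_first`).

Uniqueness for arcs: since the complement is not bipartite, two cliques never cover the circle, and
every edge runs exactly one way round it (`IsArcEnumeration.exists_isRound`, `IsRound.fwd_iff_not`).
This orients the graph. The ends of an induced path on three vertices lie on opposite sides of its
middle, so both edges point along the path (`IsRound.fwd_path_iff`). Hence whether two
representations orient an edge alike is constant along induced paths, and `IsRound.col_iff_col`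
shows that such a property is constant on all edges between non-twins. The orientations therefore
agree or are opposite; after a possible reflection they agree, and an orientation fixes the cyclic
order up to rotation and twins (`IsRound.exists_shift_twin`). -/

/-! ### Closed adjacency and twins of a graph -/

/-- `u` lies in the closed neighborhood of `v`. -/
def ClosedAdj {V : Type*} (G : SimpleGraph V) (u v : V) : Prop := u = v ∨ G.Adj u v

/-- Two vertices have the same closed neighborhood. -/
def Twin {V : Type*} (G : SimpleGraph V) (u v : V) : Prop :=
  ∀ w, ClosedAdj G u w ↔ ClosedAdj G v w

section ClosedAdj

variable {V : Type*} {G : SimpleGraph V} {u v w : V}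

theorem ClosedAdj.refl (G : SimpleGraph V) (u : V) : ClosedAdj G u u := Or.inl rfl

theorem ClosedAdj.symm (h : ClosedAdj G u v) : ClosedAdj G v u :=
  h.imp Eq.symm fun h => h.symm

theorem closedAdj_comm : ClosedAdj G u v ↔ ClosedAdj G v u := ⟨.symm, .symm⟩

theorem Twin.refl (G : SimpleGraph V) (u : V) : Twin G u u := fun _ => Iff.rfl

theorem Twin.symm (h : Twin G u v) : Twin G v u := fun w => (h w).symm

theorem Twin.trans (h : Twin G u v) (h' : Twin G v w) : Twin G u w :=
  fun x => (h x).trans (h' x)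

theorem Twin.closedAdj (h : Twin G u v) : ClosedAdj G u v := (h v).2 (.refl G v)

theorem Twin.closedAdj_right (h : Twin G u v) : ClosedAdj G w u ↔ ClosedAdj G w v := by
  rw [closedAdj_comm, h w, closedAdj_comm]

theorem mem_insert_neighborSet_iff : u ∈ insert v (G.neighborSet v) ↔ ClosedAdj G v u := by
  simp only [Set.mem_insert_iff, SimpleGraph.mem_neighborSet, ClosedAdj, eq_comm]

theorem areTwins_iff_twin : AreTwins (closedNeighborhoodHypergraph G) u v ↔ Twin G u v := by
  simp only [AreTwins, closedNeighborhoodHypergraph, Set.forall_mem_range,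
    mem_insert_neighborSet_iff, Twin]
  exact forall_congr' fun w => by rw [@closedAdj_comm _ _ w u, @closedAdj_comm _ _ w v]

end ClosedAdj

/-! ### Permutations preserving twin classes -/

/-- Induction on the size of the support: composing with the swap of `v` and `π v`, a transposition
of twins, fixes `v` and moves no new vertex. -/
theorem isTwinPermutation_of_forall_twin {V : Type*} [Finite V] {G : SimpleGraph V}
    (π : Equiv.Perm V) (h : ∀ v, Twin G (π v) v) :
    IsTwinPermutation (closedNeighborhoodHypergraph G) π := by
  classical
  have := Fintype.ofFinite V
  induction hn : π.support.card using Nat.strong_induction_on generalizing π with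
  | _ n ih =>
    by_cases h1 : π = 1
    · subst h1; exact one_mem _
    · obtain ⟨v, hv⟩ : ∃ v, π v ≠ v := by
        by_contra! hc; exact h1 (Equiv.ext hc)
      have hlt : (Equiv.swap v (π v) * π).support.card < n :=
        hn ▸ Equiv.Perm.card_support_swap_mul hv
      have hm := ih _ hlt (Equiv.swap v (π v) * π) (fun w => by
        refine Twin.trans ?_ (h w)
        simp only [Equiv.Perm.mul_apply]
        by_cases ha : π w = v
        · rw [ha, Equiv.swap_apply_left]; exact h v
        by_cases hb : π w = π v
        · rw [hb, Equiv.swap_apply_right]; exact (h v).symm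
        · rw [Equiv.swap_apply_of_ne_of_ne ha hb]; exact .refl G _) rfl
      have ht : Equiv.swap v (π v) ∈ Submonoid.closure
          {τ : Equiv.Perm V | IsTwinTransposition (closedNeighborhoodHypergraph G) τ} :=
        Submonoid.subset_closure ⟨v, π v, areTwins_iff_twin.2 (h v).symm,
          fun w h1 h2 => Equiv.swap_apply_of_ne_of_ne h1 h2⟩
      have := mul_mem ht hm
      rwa [Equiv.swap_mul_self_mul] at this

/-- If two enumerations of a finite type agree up to an equivalence relation on `B`, then each
class met by the second one outside `B` is also met by the first one outside `B`. -/
theorem exists_notMem_rel_of_agree {α V : Type*} [Finite α] (r : V → V → Prop)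
    (rs : ∀ {u v}, r u v → r v u) (rt : ∀ {u v w}, r u v → r v w → r u w)
    (rr : ∀ u, r u u) (p p' : α ≃ V) (B : Set α) (h : ∀ i ∈ B, r (p i) (p' i)) {k : α}
    (hk : k ∉ B) : ∃ q ∉ B, r (p q) (p' k) := by
  by_contra! hc
  -- A class occupies equally many positions in both enumerations. If `p` met the class of `p' k`
  -- only inside `B`, these positions would also belong to the class for `p'`, which has `k` in
  -- addition.
  let S : Set α := {i | r (p i) (p' k)}
  let T : Set α := {i | r (p' i) (p' k)}
  have hSB : S ⊆ B := fun i hi => by by_contra hB; exact hc i hB hi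
  have hST : S ⊆ T := fun i hi => rt (rs (h i (hSB hi))) hi
  have hcard : S.ncard = T.ncard := by
    have h1 : p '' S = {v | r v (p' k)} := by
      ext v; simp [S, Equiv.image_eq_preimage_symm]
    have h2 : p' '' T = {v | r v (p' k)} := by
      ext v; simp [T, Equiv.image_eq_preimage_symm]
    rw [← Set.ncard_image_of_injective S p.injective, ← Set.ncard_image_of_injective T p'.injective,
      h1, h2]
  have := Set.eq_of_subset_of_ncard_le hST hcard.ge (Set.toFinite T)
  exact hk (hSB (this ▸ (rr _ : k ∈ T)))

/-! ### Uniqueness of interval representations -/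

/-- The order transported by `lam` satisfies the umbrella property. -/
def IsUmbrella {V : Type*} {n : ℕ} (G : SimpleGraph V) (lam : V ≃ Fin n) : Prop :=
  ∀ i j k : Fin n, i ≤ j → j ≤ k → ClosedAdj G (lam.symm i) (lam.symm k) →
    ClosedAdj G (lam.symm i) (lam.symm j) ∧ ClosedAdj G (lam.symm j) (lam.symm k)

section Interval

variable {V : Type*} {n : ℕ} {G : SimpleGraph V}

theorem IsIntervalRepresentation.isUmbrella {lam : V ≃ Fin n}
    (h : IsIntervalRepresentation (closedNeighborhoodHypergraph G) lam) : IsUmbrella G lam := by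
  have key : ∀ v, ∃ a b : Fin n, ∀ i, ClosedAdj G v (lam.symm i) ↔ a ≤ i ∧ i ≤ b := by
    intro v
    have hA := h.2 (lam '' insert v (G.neighborSet v)) ⟨_, ⟨v, rfl⟩, rfl⟩
    have hmem : ∀ i, i ∈ lam '' insert v (G.neighborSet v) ↔ ClosedAdj G v (lam.symm i) := by
      intro i
      rw [Equiv.image_eq_preimage_symm, Set.mem_preimage, mem_insert_neighborSet_iff]
    rcases hA with hA | ⟨a, b, hA⟩
    · have := (hmem (lam v)).2 (by simpa using ClosedAdj.refl G v)
      rw [hA] at this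
      exact this.elim
    · exact ⟨a, b, fun i => by rw [← hmem, hA, Set.mem_Icc]⟩
  intro i j k hij hjk hik
  obtain ⟨a, b, h1⟩ := key (lam.symm i)
  obtain ⟨c, d, h2⟩ := key (lam.symm k)
  have e1 := (h1 i).1 (.refl G _)
  have e2 := (h1 k).1 hik
  have e3 := (h2 i).1 hik.symm
  have e4 := (h2 k).1 (.refl G _)
  exact ⟨(h1 j).2 ⟨e1.1.trans hij, hjk.trans e2.2⟩,
    ((h2 j).2 ⟨e3.1.trans hij, hjk.trans e4.2⟩).symm⟩

theorem IsUmbrella.rev {lam : V ≃ Fin n} (h : IsUmbrella G lam) :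
    IsUmbrella G (lam.trans Fin.revPerm) := by
  intro i j k hij hjk hik
  have := h k.rev j.rev i.rev (Fin.rev_le_rev.2 hjk) (Fin.rev_le_rev.2 hij) hik.symm
  exact ⟨this.2.symm, this.1.symm⟩

/-- In a connected graph, a nonempty proper set of vertices has an edge leaving it. -/
theorem exists_adj_of_connected (hG : G.Connected) (S : Set V) {a b : V} (ha : a ∈ S)
    (hb : b ∉ S) : ∃ x ∈ S, ∃ y ∉ S, G.Adj x y := by
  obtain ⟨p⟩ := hG.preconnected a b
  obtain ⟨d, -, h1, h2⟩ := p.exists_boundary_dart S ha hb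
  exact ⟨_, h1, _, h2, d.adj⟩

/-- Some edge leaves the initial segment ending at `i`; it passes over both `i` and `j`, and the
umbrella property shrinks it to them. -/
theorem IsUmbrella.adj_succ (hG : G.Connected) {lam : V ≃ Fin n} (h : IsUmbrella G lam)
    {i j : Fin n} (hij : i.1 + 1 = j.1) : ClosedAdj G (lam.symm i) (lam.symm j) := by
  obtain ⟨x, hx, y, hy, hxy⟩ := exists_adj_of_connected hG {v | lam v ≤ i}
    (a := lam.symm i) (b := lam.symm j) (by simp) (by simp only [Set.mem_ofPred_eq, Equiv.apply_symm_apply, Fin.le_def]; omega)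
  simp only [Set.mem_ofPred_eq, not_le] at hx hy
  have h1 := h (lam x) i (lam y) hx hy.le (by simp only [Equiv.symm_apply_apply]; exact Or.inr hxy)
  have h2 := h i j (lam y) (by rw [Fin.le_def]; omega) (by rw [Fin.le_def]; rw [Fin.lt_def] at hy; omega) h1.2
  exact h2.1

/-- Two umbrella orders with twin first vertices coincide up to twins. -/
theorem IsUmbrella.twin_of_first (hG : G.Connected) {lam lam' : V ≃ Fin n}
    (h : IsUmbrella G lam) (h' : IsUmbrella G lam')
    (h0 : ∀ i : Fin n, i.1 = 0 → Twin G (lam.symm i) (lam'.symm i)) (i : Fin n) :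
    Twin G (lam.symm i) (lam'.symm i) := by
  induction hi : i.1 using Nat.strong_induction_on generalizing i with
  | _ k ih =>
    subst hi
    rcases Nat.eq_zero_or_pos i.1 with h00 | hpos
    · exact h0 i h00
    have ih' : ∀ j < i, Twin G (lam.symm j) (lam'.symm j) := fun j hj => ih j.1 hj j rfl
    -- the neighbourhood of `lam.symm i` is contained in that of any later vertex which is
    -- a neighbour of the previous one
    have main : ∀ (mu mu' : V ≃ Fin n), IsUmbrella G mu → IsUmbrella G mu' →
        (∀ j < i, Twin G (mu.symm j) (mu'.symm j)) →
        (∃ q, i ≤ q ∧ Twin G (mu.symm q) (mu'.symm i)) →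
        (∃ q, i ≤ q ∧ Twin G (mu'.symm q) (mu.symm i)) →
        ∀ w, ClosedAdj G (mu.symm i) w → ClosedAdj G (mu'.symm i) w := by
      rintro mu mu' hm hm' hag ⟨q, hq, hqt⟩ ⟨q', hq', hqt'⟩ w hw
      let u : Fin n := ⟨i.1 - 1, by omega⟩
      have hui : u.1 + 1 = i.1 := by simp only [u]; omega
      have hu : u < i := by rw [Fin.lt_def]; omega
      -- Up to twins, this is the edge between the consecutive positions `u` and `i` of `mu'`.
      have huq : ClosedAdj G (mu.symm u) (mu.symm q) := by
        rw [hqt.closedAdj_right, hag u hu]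
        exact hm'.adj_succ hG hui
      rcases lt_or_ge (mu w) i with hwi | hwi
      · -- earlier neighbours: use the order `mu'`
        have hw' : ClosedAdj G (mu.symm i) (mu.symm (mu w)) := by simpa using hw
        rw [← hqt', closedAdj_comm, (hag _ hwi)] at hw'
        have := (hm' (mu w) i q' hwi.le hq' hw').1
        rw [← hag _ hwi] at this
        simpa using this.symm
      · rw [← hqt]
        have hw' : ClosedAdj G (mu.symm i) (mu.symm (mu w)) := by simpa using hw
        -- Up to `q`, the vertex `w` lies under the edge from `u` to `q`; beyond `q`, the edge from
        -- `i` to `w` passes over `q`.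
        rcases le_total (mu w) q with hc | hc
        · simpa using ((hm u (mu w) q (hu.le.trans hwi) hc huq).2).symm
        · simpa using (hm i q (mu w) hq hc hw').2
    have hr : ∀ mu mu' : V ≃ Fin n, (∀ j < i, Twin G (mu.symm j) (mu'.symm j)) →
        ∃ q, i ≤ q ∧ Twin G (mu.symm q) (mu'.symm i) := by
      intro mu mu' hag
      obtain ⟨q, hq, hqt⟩ := exists_notMem_rel_of_agree (Twin G) Twin.symm Twin.trans (Twin.refl G)
        mu.symm mu'.symm (Set.Iio i) hag (k := i) (by simp)
      exact ⟨q, by simpa using hq, hqt⟩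
    have ih'' : ∀ j < i, Twin G (lam'.symm j) (lam.symm j) := fun j hj => (ih' j hj).symm
    intro w
    exact ⟨main lam lam' h h' ih' (hr _ _ ih') (hr _ _ ih'') w,
      main lam' lam h' h ih'' (hr _ _ ih'') (hr _ _ ih') w⟩

/-- The first vertex of an umbrella order is a twin of one of the two end vertices of any other
umbrella order. -/
theorem IsUmbrella.first_twin_end (hG : G.Connected) {lam lam' : V ≃ Fin n}
    (h : IsUmbrella G lam) (h' : IsUmbrella G lam') {o : Fin n} (ho : o.1 = 0) :
    Twin G (lam.symm o) (lam'.symm o) ∨ Twin G (lam.symm o.rev) (lam'.symm o) := by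
  classical
  set x := lam'.symm o with hx
  -- the closed neighbourhood of `x` is a clique, and an initial segment of `lam'`
  have ho' : ∀ j : Fin n, o ≤ j := fun j => by rw [Fin.le_def]; omega
  have hrev : ∀ j : Fin n, j ≤ o.rev := fun j => by
    rw [Fin.le_def, Fin.val_rev]; omega
  have hinit : ∀ u v, lam' u ≤ lam' v → ClosedAdj G x v → ClosedAdj G x u := by
    intro u v huv hv
    have := (h' o (lam' u) (lam' v) (ho' _) huv (by simpa [← hx] using hv)).1
    simpa [← hx] using this
  have hmid : ∀ u v, lam' u ≤ lam' v → ClosedAdj G x v → ClosedAdj G u v := by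
    intro u v huv hv
    have := (h' o (lam' u) (lam' v) (ho' _) huv (by simpa [← hx] using hv)).2
    simpa using this
  have hclique : ∀ u v, ClosedAdj G x u → ClosedAdj G x v → ClosedAdj G u v := by
    intro u v hu hv
    rcases le_total (lam' u) (lam' v) with hc | hc
    · exact hmid u v hc hv
    · exact (hmid v u hc hu).symm
  let S : Finset (Fin n) := Finset.univ.filter fun i => ClosedAdj G x (lam.symm i)
  have hS : ∀ i, i ∈ S ↔ ClosedAdj G x (lam.symm i) := fun i => by simp [S]
  have hSne : S.Nonempty := ⟨lam x, (hS _).2 (by simpa using ClosedAdj.refl G x)⟩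
  set L := S.min' hSne with hL
  set R := S.max' hSne with hR
  have hLS : ClosedAdj G x (lam.symm L) := (hS _).1 (S.min'_mem hSne)
  have hRS : ClosedAdj G x (lam.symm R) := (hS _).1 (S.max'_mem hSne)
  have hLx : L ≤ lam x := S.min'_le _ ((hS _).2 (by simpa using ClosedAdj.refl G x))
  have hxR : lam x ≤ R := S.le_max' _ ((hS _).2 (by simpa using ClosedAdj.refl G x))
  -- Otherwise non-neighbors `a`, `b` of `x` sit just outside `L` and `R`. In `lam'` they come after
  -- all of `N[x]`. If `L` precedes `R` there, the edge from `L` to `a` passes over `R`, so `a` and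
  -- `R` are adjacent; in `lam` this new edge passes over `x`, making `a` a neighbor of `x`. The
  -- other case is symmetric.
  have hend : L = o ∨ R = o.rev := by
    by_contra! hc
    have hc1 : 0 < L.1 := Nat.pos_of_ne_zero fun h0 => hc.1 (Fin.ext (by omega))
    have hc2 : R.1 + 1 < n := by
      by_contra hcc
      exact hc.2 (Fin.ext (by rw [Fin.val_rev]; omega))
    let a : Fin n := ⟨L.1 - 1, by omega⟩
    let b : Fin n := ⟨R.1 + 1, hc2⟩
    have haL : a < L := by rw [Fin.lt_def]; simp only [a]; omega
    have hRb : R < b := by rw [Fin.lt_def]; simp only [b]; omega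
    have ha : ¬ ClosedAdj G x (lam.symm a) := fun hh =>
      absurd (S.min'_le a ((hS _).2 hh)) (not_le.2 haL)
    have hb : ¬ ClosedAdj G x (lam.symm b) := fun hh =>
      absurd (S.le_max' b ((hS _).2 hh)) (not_le.2 hRb)
    have haL' : ClosedAdj G (lam.symm a) (lam.symm L) :=
      h.adj_succ hG (by simp only [a]; omega)
    have hRb' : ClosedAdj G (lam.symm R) (lam.symm b) := h.adj_succ hG rfl
    rcases le_total (lam' (lam.symm L)) (lam' (lam.symm R)) with hc | hc
    · have hlt : lam' (lam.symm R) ≤ lam' (lam.symm a) :=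
        (le_total _ _).resolve_right fun hh => ha (hinit _ _ hh hRS)
      have h1 := (h' _ _ _ hc hlt (by simpa using haL'.symm)).2
      have h2 := (h a (lam x) R (haL.le.trans hLx) hxR (by simpa using h1.symm)).1
      exact ha (by simpa using h2.symm)
    · have hlt : lam' (lam.symm L) ≤ lam' (lam.symm b) :=
        (le_total _ _).resolve_right fun hh => hb (hinit _ _ hh hLS)
      have h1 := (h' _ _ _ hc hlt (by simpa using hRb')).2
      have h2 := (h L (lam x) b hLx (hxR.trans hRb.le) (by simpa using h1)).2
      exact hb (by simpa using h2)
  -- As `N[x]` is a clique, only the inclusion of the other neighborhood in `N[x]` has to be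
  -- checked.
  have hfin : ∀ e, ClosedAdj G x (lam.symm e) →
      (∀ w, ClosedAdj G (lam.symm e) w → ClosedAdj G x w) → Twin G (lam.symm e) x :=
    fun e he hw w => ⟨hw w, fun hxw => hclique _ _ he hxw⟩
  rcases hend with he | he
  · refine Or.inl (hfin o (he ▸ hLS) fun w hw => ?_)
    rcases le_total (lam w) (lam x) with hc | hc
    · simpa using ((h L (lam w) (lam x) (he ▸ ho' _) hc (by simpa using hLS.symm)).2).symm
    · simpa using (h o (lam x) (lam w) (ho' _) hc (by simpa using hw)).2
  · refine Or.inr (hfin o.rev (he ▸ hRS) fun w hw => ?_)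
    rcases le_total (lam w) (lam x) with hc | hc
    · simpa using ((h (lam w) (lam x) o.rev hc (hrev _) (by simpa using hw.symm)).1).symm
    · simpa using (h (lam x) (lam w) R hc (he ▸ hrev _) (by simpa using hRS)).1

theorem intervalEquivalent_of_isUmbrella [Finite V] (hG : G.Connected) {lam lam' : V ≃ Fin n}
    (h : IsUmbrella G lam) (h' : IsUmbrella G lam') :
    IntervalEquivalent (closedNeighborhoodHypergraph G) lam lam' := by
  have fin : ∀ mu : V ≃ Fin n, (∀ i, Twin G (mu.symm i) (lam'.symm i)) →
      ∃ π : Equiv.Perm V, IsTwinPermutation (closedNeighborhoodHypergraph G) π ∧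
        ∀ v, lam' v = mu (π v) := by
    intro mu hmu
    refine ⟨lam'.trans mu.symm, isTwinPermutation_of_forall_twin _ fun v => ?_, fun v => ?_⟩
    · simpa using hmu (lam' v)
    · simp
  obtain ⟨v⟩ := hG.nonempty
  have hn : 0 < n := (lam v).pos
  rcases h.first_twin_end hG h' (o := ⟨0, hn⟩) rfl with ht | ht
  · obtain ⟨π, hπ, hv⟩ := fin lam (h.twin_of_first hG h' fun i hi => by
      rwa [show i = ⟨0, hn⟩ from Fin.ext hi])
    exact ⟨1, π, Or.inl fun _ => rfl, hπ, hv⟩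
  · obtain ⟨π, hπ, hv⟩ := fin (lam.trans Fin.revPerm) (h.rev.twin_of_first hG h' fun i hi => by
      rw [show i = ⟨0, hn⟩ from Fin.ext hi]; exact ht)
    exact ⟨Fin.revPerm, π, Or.inr fun _ => rfl, hπ, hv⟩

end Interval

/-! ### Existence of representations -/

theorem Set.Finite.exists_eq_Icc {α : Type*} [LinearOrder α] {T : Set α} (hf : T.Finite)
    (hne : T.Nonempty) (hc : ∀ x ∈ T, ∀ z ∈ T, ∀ y, x ≤ y → y ≤ z → y ∈ T) :
    ∃ a b, a ≤ b ∧ T = Set.Icc a b := by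
  obtain ⟨b, hb, hb'⟩ := Set.exists_max_image T id hf hne
  obtain ⟨a, ha, ha'⟩ := Set.exists_min_image T id hf hne
  refine ⟨a, b, hb' a ha, ?_⟩
  ext y
  exact ⟨fun hy => ⟨ha' y hy, hb' y hy⟩, fun hy => hc a ha b hb y hy.1 hy.2⟩

theorem exists_equiv_fin_lt_iff {V : Type*} [Fintype V] (s : V → ℕ)
    (hs : Function.Injective s) :
    ∃ e : V ≃ Fin (Fintype.card V), ∀ u v, e u < e v ↔ s u < s v := by
  let _ : LinearOrder V := LinearOrder.lift' s hs
  refine ⟨(monoEquivOfFin V rfl).symm.toEquiv, fun u v => ?_⟩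
  exact (monoEquivOfFin V rfl).symm.lt_iff_lt

/-- Order by `s`; then `t` is monotone too. If `v` meets `x` and `z`, any `y` between them has `s y
≤ s z ≤ t v` and `s v ≤ t x ≤ t y`. -/
theorem exists_isIntervalRepresentation_of_endpoints {V : Type*} [Fintype V] {G : SimpleGraph V}
    (s t : V → ℕ) (hs : Function.Injective s) (hst : ∀ u v, s u < s v → t u ≤ t v)
    (hadj : ∀ u v, ClosedAdj G u v ↔ s v ≤ t u ∧ s u ≤ t v) :
    ∃ lam : V ≃ Fin (Fintype.card V),
      IsIntervalRepresentation (closedNeighborhoodHypergraph G) lam := by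
  obtain ⟨e, he⟩ := exists_equiv_fin_lt_iff s hs
  have hle : ∀ u v, e u ≤ e v → s u ≤ s v := fun u v h => by
    by_contra hc; exact absurd ((he v u).2 (not_le.1 hc)) (not_lt.2 h)
  have hle' : ∀ u v, e u ≤ e v → t u ≤ t v := fun u v h => by
    rcases h.lt_or_eq with h | h
    · exact hst _ _ ((he _ _).1 h)
    · rw [e.injective h]
  refine ⟨e, ?_, ?_⟩
  · simp [closedNeighborhoodHypergraph]
  · rintro _ ⟨_, ⟨v, rfl⟩, rfl⟩
    right
    have hmem : ∀ i, i ∈ e '' insert v (G.neighborSet v) ↔ ClosedAdj G v (e.symm i) := by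
      intro i
      rw [Equiv.image_eq_preimage_symm, Set.mem_preimage, mem_insert_neighborSet_iff]
    obtain ⟨a, b, -, h⟩ := (Set.toFinite (e '' insert v (G.neighborSet v))).exists_eq_Icc
      ⟨e v, by simp⟩ (by
        intro x hx z hz y hxy hyz
        rw [hmem, hadj] at *
        have h1 := hle (e.symm x) (e.symm y) (by simpa using hxy)
        have h2 := hle' (e.symm x) (e.symm y) (by simpa using hxy)
        have h3 := hle (e.symm y) (e.symm z) (by simpa using hyz)
        omega)
    exact ⟨a, b, h⟩

/-- A graph is the intersection graph of the pairwise incomparable sets `A v`. -/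
structure IsProperModel {V α : Type*} (G : SimpleGraph V) (A : V → Set α) : Prop where
  eq_of_subset : ∀ {u v}, A u ⊆ A v → u = v
  adj_iff : ∀ {u v}, u ≠ v → (G.Adj u v ↔ (A u ∩ A v).Nonempty)

theorem isProperModel_of_iso {V α : Type*} {G : SimpleGraph V} {H : Hypergraph α}
    (hH : IsProperHypergraph H) (e : G ≃g intersectionGraph H) :
    IsProperModel G fun v => (e v : Set α) where
  eq_of_subset {u v} h := by
    by_contra hne
    exact hH (e u).2 (e v).2 (fun hc => hne (e.injective (Subtype.ext hc))) h
  adj_iff {u v} hne := by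
    rw [← e.map_adj_iff]
    exact ⟨fun h => h.2, fun h => ⟨fun hc => hne (e.injective hc), h⟩⟩

theorem IsProperModel.closedAdj_iff {V α : Type*} {G : SimpleGraph V} {A : V → Set α}
    (h : IsProperModel G A) (hA : ∀ v, (A v).Nonempty) {u v : V} :
    ClosedAdj G u v ↔ (A u ∩ A v).Nonempty := by
  by_cases huv : u = v
  · subst huv; simp [ClosedAdj, hA]
  · simp [ClosedAdj, huv, h.adj_iff huv]

theorem IsProperModel.subsingleton {V α : Type*} {G : SimpleGraph V} {A : V → Set α}
    (h : IsProperModel G A) {v : V} (hv : A v = ∅) : Subsingleton V := by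
  have : ∀ u, v = u := fun u => h.eq_of_subset (hv ▸ Set.empty_subset _)
  exact ⟨fun a b => (this a).symm.trans (this b)⟩

theorem IsProperIntervalGraph.exists_isIntervalRepresentation {V : Type*} [Fintype V]
    {G : SimpleGraph V} (h : IsProperIntervalGraph G) :
    ∃ lam : V ≃ Fin (Fintype.card V),
      IsIntervalRepresentation (closedNeighborhoodHypergraph G) lam := by
  obtain ⟨m, I, hI, hp, ⟨e⟩⟩ := h
  have hm := isProperModel_of_iso hp e
  by_cases hne : ∀ v, ((e v : Set (Fin m))).Nonempty
  · have hab : ∀ v, ∃ a b : Fin m, (e v : Set (Fin m)) = Set.Icc a b := fun v =>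
      (hI.2 _ (e v).2).resolve_left (hne v).ne_empty
    choose a b hab using hab
    have hle : ∀ v, a v ≤ b v := fun v => Set.nonempty_Icc.1 (hab v ▸ hne v)
    have hsub : ∀ u v, a v ≤ a u → b u ≤ b v → u = v := fun u v h1 h2 =>
      hm.eq_of_subset (by simp only [hab]; exact Set.Icc_subset_Icc h1 h2)
    refine exists_isIntervalRepresentation_of_endpoints (fun v => (a v).1) (fun v => (b v).1)
      (fun u v huv => ?_) (fun u v huv => ?_) fun u v => ?_
    · have huv : a u = a v := Fin.ext huv
      rcases le_total (b u) (b v) with hc | hc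
      · exact hsub u v huv.ge hc
      · exact (hsub v u huv.le hc).symm
    · by_contra! hc
      have := hsub v u (Fin.le_def.2 huv.le) (Fin.le_def.2 hc.le)
      subst this
      exact lt_irrefl _ hc
    · rw [hm.closedAdj_iff hne]
      simp only [hab, Set.Icc_inter_Icc, Set.nonempty_Icc, sup_le_iff, le_inf_iff, ← Fin.le_def]
      have := hle u
      have := hle v
      tauto
  -- An empty interval lies inside every other one, so by incomparability it is alone.
  · push Not at hne
    obtain ⟨v, hv⟩ := hne
    have := hm.subsingleton (v := v) hv
    exact exists_isIntervalRepresentation_of_endpoints (fun _ => 0) (fun _ => 0)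
      (fun u v _ => Subsingleton.elim u v) (by simp) fun u v => by
        simp [ClosedAdj, Subsingleton.elim u v]

/-! ### Arcs and integer intervals -/

theorem circleArc_eq_image {n : ℕ} [NeZero n] (a b : ZMod n) :
    circleArc a b = ((↑) : ℤ → ZMod n) '' Set.Icc (a.val : ℤ) (a.val + (b - a).val) := by
  ext x
  simp only [circleArc, Set.mem_image, Set.mem_Icc]
  constructor
  · intro h
    refine ⟨a.val + (x - a).val, ⟨by omega, by simp only [Set.mem_ofPred_eq] at h; omega⟩, ?_⟩
    push_cast
    simp
  · rintro ⟨z, ⟨h1, h2⟩, rfl⟩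
    obtain ⟨k, rfl⟩ := Int.le.dest h1
    have hk : k ≤ (b - a).val := by omega
    have : ((((a.val : ℤ) + k : ℤ) : ZMod n) - a) = (k : ZMod n) := by push_cast; simp
    rw [Set.mem_ofPred_eq, this]
    exact ((ZMod.val_natCast n _).trans_le (Nat.mod_le _ _)).trans hk

theorem isArc_image_Icc {n : ℕ} (hn : n ≠ 0) (a b : ℤ) :
    IsArc (((↑) : ℤ → ZMod n) '' Set.Icc a b) := by
  have : NeZero n := ⟨hn⟩
  rcases lt_or_ge b a with hab | hab
  · left; simp [Set.Icc_eq_empty (not_le.2 hab)]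
  right
  rcases lt_or_ge (b - a) n with hlt | hge
  · refine ⟨a, b, ?_⟩
    obtain ⟨k, rfl⟩ := Int.le.dest hab
    have hk : (((a + k : ℤ) : ZMod n) - a).val = k := by
      push_cast
      rw [add_sub_cancel_left, ZMod.val_natCast_of_lt (by omega)]
    ext x
    simp only [circleArc, Set.mem_image, Set.mem_Icc, hk, Set.mem_ofPred_eq]
    constructor
    · rintro ⟨z, ⟨h1, h2⟩, rfl⟩
      obtain ⟨t, rfl⟩ := Int.le.dest h1
      have : (((a + t : ℤ) : ZMod n) - a) = (t : ZMod n) := by push_cast; ring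
      rw [this]
      exact ((ZMod.val_natCast n _).trans_le (Nat.mod_le _ _)).trans (by omega)
    · intro h
      exact ⟨a + (x - a).val, ⟨by omega, by omega⟩, by push_cast; simp⟩
  -- The interval winds round the whole circle, which is the arc from `0` to its predecessor.
  · refine ⟨0, -1, ?_⟩
    have h1 : circleArc (0 : ZMod n) (-1) = Set.univ := by
      refine Set.eq_univ_of_forall fun x => ?_
      obtain ⟨k, rfl⟩ : ∃ k, n = k + 1 := ⟨n - 1, by omega⟩
      simp only [circleArc, sub_zero, Set.mem_ofPred_eq, ZMod.val_neg_one]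
      have := ZMod.val_lt x
      omega
    rw [h1]
    refine Set.eq_univ_of_forall fun x => ⟨a + (x - (a : ZMod n)).val, ⟨by omega, ?_⟩, by push_cast; simp⟩
    have := ZMod.val_lt (x - (a : ZMod n))
    omega

theorem IsArc.exists_eq_image {n : ℕ} (hn : n ≠ 0) {A : Set (ZMod n)} (h : IsArc A)
    (hA : A.Nonempty) :
    ∃ a b : ℤ, 0 ≤ a ∧ a < n ∧ a ≤ b ∧ A = ((↑) : ℤ → ZMod n) '' Set.Icc a b := by
  have : NeZero n := ⟨hn⟩
  obtain ⟨a, b, rfl⟩ := h.resolve_left hA.ne_empty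
  have := ZMod.val_lt a
  exact ⟨_, _, by omega, by omega, by omega, circleArc_eq_image a b⟩

theorem IsProperCircularArcGraph.exists_isArcRepresentation {V : Type*} [Fintype V]
    {G : SimpleGraph V} (h : IsProperCircularArcGraph G) (hb : ¬ Gᶜ.IsBipartite) :
    ∃ lam : V ≃ ZMod (Fintype.card V),
      IsArcRepresentation (closedNeighborhoodHypergraph G) lam := by
  obtain ⟨m, I, hI, hp, ⟨ei⟩⟩ := h
  have hm := isProperModel_of_iso hp ei
  have hV : ¬ Subsingleton V := fun _ => hb ⟨SimpleGraph.Coloring.mk (fun _ => 0)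
    fun {u v} huv => absurd (Subsingleton.elim u v) huv.ne⟩
  have hne : ∀ v, ((ei v : Set (ZMod m))).Nonempty := fun v =>
    Set.nonempty_iff_ne_empty.2 fun hv => hV (hm.subsingleton hv)
  set n := Fintype.card V with hn
  have hn0 : 0 < n := by
    by_contra hc
    exact hV (Fintype.card_le_one_iff_subsingleton.1 (by omega))
  have hm0 : 0 < m := Nat.pos_of_ne_zero hI.1
  have : NeZero n := ⟨hn0.ne'⟩
  set A : V → Set (ZMod m) := fun v => (ei v : Set (ZMod m)) with hA
  choose s t hs0 hsm hst hst' using fun v => (hI.2.2 _ (ei v).2).exists_eq_image hI.1 (hne v)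
  change ∀ v, A v = _ at hst'
  -- Arcs with the same starting point are comparable.
  have hsinj : Function.Injective s := by
    intro u v huv
    rcases le_total (t u) (t v) with hc | hc
    · exact hm.eq_of_subset (u := u) (v := v) (by
        rw [hst', hst', huv]; exact Set.image_mono (Set.Icc_subset_Icc le_rfl hc))
    · exact (hm.eq_of_subset (u := v) (v := u) (by
        rw [hst', hst', huv]; exact Set.image_mono (Set.Icc_subset_Icc le_rfl hc))).symm
  obtain ⟨e, he⟩ := exists_equiv_fin_lt_iff (fun v => (s v).toNat) fun u v huv => hsinj (by
    have := hs0 u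
    have := hs0 v
    simp only at huv
    omega)
  have hinj : Function.Injective fun v => ((e v : ℕ) : ZMod n) := by
    intro u v huv
    have := (ZMod.natCast_eq_natCast_iff' _ _ _).1 huv
    rw [Nat.mod_eq_of_lt (e u).2, Nat.mod_eq_of_lt (e v).2] at this
    exact e.injective (Fin.ext this)
  let lam : V ≃ ZMod n := Equiv.ofBijective (fun v => ((e v : ℕ) : ZMod n))
    ((Fintype.bijective_iff_injective_and_card _).2 ⟨hinj, by rw [ZMod.card]⟩)
  let P : ℤ → V := fun i => lam.symm i
  have hlamP : ∀ i, lam (P i) = i := fun i => by simp [P]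
  have heP : ∀ i, ((e (P i) : ℕ) : ℤ) = i % n := by
    intro i
    have h1 : (((e (P i) : ℕ) : ℤ) : ZMod n) = (i : ZMod n) := by
      push_cast; exact hlamP i
    rw [ZMod.intCast_eq_intCast_iff'] at h1
    rwa [Int.emod_eq_of_lt (by omega) (by have := (e (P i)).2; omega)] at h1
  have hPadd : ∀ i k : ℤ, P (i + n * k) = P i := fun i k => by simp [P]
  have hPeq : ∀ i j : ℤ, P i = P j → ∃ k, j = i + n * k := by
    intro i j hij
    have h1 : (i : ZMod n) = j := lam.symm.injective hij
    obtain ⟨k, hk⟩ := (ZMod.intCast_eq_intCast_iff_dvd_sub _ _ _).1 h1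
    exact ⟨k, by omega⟩
  -- Lifted endpoints of the arc at position `i`: a turn of `n` positions among the vertices
  -- advances by `m` points of the model.
  let σ : ℤ → ℤ := fun i => (i / n) * m + s (P i)
  let τ : ℤ → ℤ := fun i => (i / n) * m + t (P i)
  have hσadd : ∀ i k, σ (i + n * k) = σ i + m * k := fun i k => by
    simp only [σ, hPadd, Int.add_mul_ediv_left i k (show (n : ℤ) ≠ 0 by omega)]; ring
  have hτadd : ∀ i k, τ (i + n * k) = τ i + m * k := fun i k => by
    simp only [τ, hPadd, Int.add_mul_ediv_left i k (show (n : ℤ) ≠ 0 by omega)]; ring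
  have hσ : StrictMono σ := by
    intro i j hij
    rcases (Int.ediv_le_ediv (show (0 : ℤ) < n by omega) hij.le).lt_or_eq with hq | hq
    · have h1 := hsm (P i)
      have h2 := hs0 (P j)
      have : (i / n + 1) * (m : ℤ) ≤ (j / n) * m :=
        mul_le_mul_of_nonneg_right (by omega) (by omega)
      simp only [σ]; linarith
    · have h1 := Int.emod_add_mul_ediv i n
      have h2 := Int.emod_add_mul_ediv j n
      rw [hq] at h1
      have h3 : e (P i) < e (P j) := by
        rw [Fin.lt_def]
        have := heP i
        have := heP j
        omega
      have h4 := (he _ _).1 h3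
      have := hs0 (P i)
      simp only [σ, hq]
      omega
  have hAP : ∀ i, A (P i) = ((↑) : ℤ → ZMod m) '' Set.Icc (σ i) (τ i) := by
    intro i
    rw [hst' (P i)]
    ext x
    constructor
    · rintro ⟨z, hz, rfl⟩
      exact ⟨(i / n) * m + z, ⟨by simp only [σ]; linarith [hz.1], by simp only [τ]; linarith [hz.2]⟩,
        by push_cast; simp⟩
    · rintro ⟨z, hz, rfl⟩
      simp only [σ, τ, Set.mem_Icc] at hz
      exact ⟨z - (i / n) * m, ⟨by linarith [hz.1], by linarith [hz.2]⟩, by push_cast; simp⟩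
  -- Otherwise the arc at `j` lies in the arc at `i`, so both positions carry the same vertex and
  -- `j` is whole turns later; but then `τ j` exceeds `τ i`.
  have hτ : StrictMono τ := by
    intro i j hij
    by_contra hc
    push Not at hc
    have h1 : P j = P i := hm.eq_of_subset (by
      rw [hAP, hAP]; exact Set.image_mono (Set.Icc_subset_Icc (hσ hij).le hc))
    obtain ⟨k, rfl⟩ := hPeq _ _ h1.symm
    have hk : 0 < k := by
      by_contra hk
      have : (n : ℤ) * k ≤ 0 := mul_nonpos_of_nonneg_of_nonpos (by omega) (by omega)
      omega
    rw [hτadd] at hc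
    have : 0 < (m : ℤ) * k := mul_pos (by omega) hk
    omega
  have hστ : ∀ i, σ i ≤ τ i := fun i => by simp only [σ, τ]; linarith [hst (P i)]
  refine ⟨lam, hn0.ne', by simp [closedNeighborhoodHypergraph], ?_⟩
  rintro _ ⟨_, ⟨v, rfl⟩, rfl⟩
  obtain ⟨i, rfl⟩ : ∃ i, P i = v := ⟨(lam v).val, by simp [P]⟩
  -- Monotonicity of `σ` and `τ` makes this set convex; their growth by at least one per step makes
  -- it finite.
  let T : Set ℤ := {j | σ j ≤ τ i ∧ σ i ≤ τ j}
  have hT : lam '' insert (P i) (G.neighborSet (P i)) = ((↑) : ℤ → ZMod n) '' T := by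
    ext x
    rw [Equiv.image_eq_preimage_symm, Set.mem_preimage, mem_insert_neighborSet_iff,
      hm.closedAdj_iff hne]
    change (A (P i) ∩ A (lam.symm x)).Nonempty ↔ _
    obtain ⟨j, rfl⟩ : ∃ j : ℤ, (j : ZMod n) = x := ⟨x.val, by simp⟩
    change (A (P i) ∩ A (P j)).Nonempty ↔ _
    constructor
    · rintro ⟨y, hy1, hy2⟩
      rw [hAP] at hy1 hy2
      obtain ⟨z, hz, rfl⟩ := hy1
      obtain ⟨w, hw, hwz⟩ := hy2
      obtain ⟨k, hk⟩ := (ZMod.intCast_eq_intCast_iff_dvd_sub _ _ _).1 hwz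
      refine ⟨j + n * k, ?_, by push_cast; simp⟩
      simp only [T, hσadd, hτadd, Set.mem_ofPred_eq]
      simp only [Set.mem_Icc] at hz hw
      omega
    · rintro ⟨j', ⟨h1, h2⟩, hj⟩
      have hP : P j = P j' := by simp only [P, hj]
      rw [hP, hAP, hAP]
      have := hστ i
      have := hστ j'
      exact ⟨((max (σ i) (σ j') : ℤ) : ZMod m), ⟨_, ⟨le_max_left _ _, by omega⟩, rfl⟩,
        ⟨_, ⟨le_max_right _ _, by omega⟩, rfl⟩⟩
  have hgrow : ∀ f : ℤ → ℤ, StrictMono f → ∀ (a : ℤ) (k : ℕ), f a + k ≤ f (a + k) := by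
    intro f hf a k
    induction k with
    | zero => simp
    | succ k ih =>
      have := hf (show a + k < a + (k + 1 : ℕ) by push_cast; omega)
      push_cast at *
      omega
  have hTf : T.Finite := by
    refine (Set.finite_Icc (i - (τ i - σ i)) (i + (τ i - σ i))).subset ?_
    rintro j ⟨h1, h2⟩
    rw [Set.mem_Icc]
    rcases le_total i j with hc | hc
    · obtain ⟨k, rfl⟩ := Int.le.dest hc
      have := hgrow σ hσ i k
      have := hστ i
      omega
    · obtain ⟨k, rfl⟩ := Int.le.dest hc
      have := hgrow τ hτ j k
      have := hστ (j + k)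
      omega
  obtain ⟨a, b, -, hab⟩ := hTf.exists_eq_Icc ⟨i, hστ i, hστ i⟩ (by
    rintro x ⟨-, hx⟩ z ⟨hz, -⟩ y hxy hyz
    exact ⟨(hσ.monotone hyz).trans hz, hx.trans (hτ.monotone hxy)⟩)
  rw [hT, hab]
  exact isArc_image_Icc hn0.ne' a b

/-! ### Round enumerations -/

/-- `P` enumerates the vertices periodically so that the closed neighborhoods are arcs. -/
structure IsArcEnumeration {V : Type*} (G : SimpleGraph V) (n : ℕ) (P : ℤ → V) : Prop where
  pos : 0 < n
  surj : Function.Surjective P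
  eq_iff : ∀ {i j : ℤ}, P i = P j ↔ (n : ℤ) ∣ j - i
  arc : ∀ {i j : ℤ}, i < j → j < i + n → ClosedAdj G (P i) (P j) →
    (∀ k, i ≤ k → k ≤ j → ClosedAdj G (P i) (P k)) ∨
      (∀ k, j ≤ k → k ≤ i + n → ClosedAdj G (P i) (P k))

/-- `P` enumerates the vertices periodically; `g i` is the first position after `i` carrying a
non-neighbor of `P i`, and `l i` is the first position from which `i` is reached. -/
structure IsRound {V : Type*} (G : SimpleGraph V) (n : ℕ) (P : ℤ → V) (g l : ℤ → ℤ) : Prop where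
  pos : 0 < n
  surj : Function.Surjective P
  eq_iff : ∀ {i j : ℤ}, P i = P j ↔ (n : ℤ) ∣ j - i
  g_add : ∀ i, g (i + n) = g i + n
  l_le_iff : ∀ {i j : ℤ}, l i ≤ j ↔ i < g j
  lt_g : ∀ i, i < g i
  g_g_lt : ∀ i, g (g i) < i + n
  closedAdj_iff : ∀ {i j : ℤ}, i < j → j < i + n →
    (ClosedAdj G (P i) (P j) ↔ j < g i ∨ i + n < g j)

section ArcEnumeration

variable {V : Type*} {G : SimpleGraph V} {n : ℕ} {P : ℤ → V}

theorem IsArcRepresentation.isArcEnumeration {lam : V ≃ ZMod n}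
    (h : IsArcRepresentation (closedNeighborhoodHypergraph G) lam) :
    IsArcEnumeration G n fun i : ℤ => lam.symm i where
  pos := Nat.pos_of_ne_zero h.1
  surj v := by
    have : NeZero n := ⟨h.1⟩
    exact ⟨(lam v).val, by simp⟩
  eq_iff {i j} := by
    rw [lam.symm.injective.eq_iff, ZMod.intCast_eq_intCast_iff_dvd_sub]
  arc {i j} hij hji hadj := by
    have hA := h.2.2 (lam '' insert (lam.symm i) (G.neighborSet (lam.symm i))) ⟨_, ⟨_, rfl⟩, rfl⟩
    obtain ⟨a, b, -, -, -, hab⟩ := hA.exists_eq_image h.1 ⟨i, by simp⟩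
    have hmem : ∀ k : ℤ, ClosedAdj G (lam.symm i) (lam.symm k) ↔
        ∃ z, (a ≤ z ∧ z ≤ b) ∧ (n : ℤ) ∣ k - z := by
      intro k
      rw [← mem_insert_neighborSet_iff, ← Set.mem_preimage, ← Equiv.image_eq_preimage_symm, hab]
      simp only [Set.mem_image, Set.mem_Icc, ZMod.intCast_eq_intCast_iff_dvd_sub]
    obtain ⟨z, hz, c, hc⟩ := (hmem i).1 (.refl G _)
    obtain ⟨w, hw, d, hd⟩ := (hmem j).1 hadj
    have hn : (0 : ℤ) < n := by exact_mod_cast Nat.pos_of_ne_zero h.1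
    rcases le_or_gt d c with hcd | hcd
    · left
      intro k hk1 hk2
      have : (n : ℤ) * d ≤ n * c := mul_le_mul_of_nonneg_left hcd hn.le
      exact (hmem k).2 ⟨k - n * c, by omega, c, by ring⟩
    · right
      intro k hk1 hk2
      have : (n : ℤ) * (c + 1) ≤ n * d := mul_le_mul_of_nonneg_left hcd hn.le
      rw [mul_add] at this
      exact (hmem k).2 ⟨k - n - n * c, by omega, c + 1, by ring⟩

theorem IsArcEnumeration.add (h : IsArcEnumeration G n P) (i : ℤ) : P (i + n) = P i :=
  h.eq_iff.2 ⟨-1, by ring⟩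

theorem exists_position (hn : 0 < n) (hs : Function.Surjective P)
    (he : ∀ {i j}, P i = P j ↔ (n : ℤ) ∣ j - i) (i : ℤ) (v : V) :
    ∃ k, i ≤ k ∧ k < i + n ∧ P k = v := by
  obtain ⟨j, rfl⟩ := hs v
  have hn' : (0 : ℤ) < n := by exact_mod_cast hn
  have h1 := Int.emod_nonneg (j - i) hn'.ne'
  have h2 := Int.emod_lt_of_pos (j - i) hn'
  refine ⟨i + (j - i) % n, by omega, by omega, he.2 ⟨(j - i) / n, ?_⟩⟩
  have := Int.emod_add_mul_ediv (j - i) n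
  linarith

/-- Since `P p` is adjacent to `P i`, its neighborhood contains one of the two arcs joining them;
one contains `o`, the other `q`. -/
theorem IsArcEnumeration.not_two_nonneighbors (h : IsArcEnumeration G n P) {i j p o q : ℤ}
    (hij : ∀ k, i ≤ k → k ≤ j → ClosedAdj G (P i) (P k)) (hpj : p ≤ j) (hio : i ≤ o)
    (hop : o < p) (hpq : p < q) (hqi : q ≤ i + n) (ho : ¬ ClosedAdj G (P p) (P o))
    (hq : ¬ ClosedAdj G (P p) (P q)) : False := by
  have h1 : ClosedAdj G (P p) (P (i + n)) := by
    rw [h.add]; exact (hij p (by omega) hpj).symm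
  rcases h.arc (by omega) (by omega) h1 with h2 | h2
  · exact hq (h2 q (by omega) (by omega))
  · refine ho ?_
    rw [← h.add o]
    exact h2 _ (by omega) (by omega)

/-- By `not_two_nonneighbors`, no vertex misses both an earlier vertex of its half and a later one
within a full turn from the start of that half. The kind of vertex missed gives the two colors, with
opposite conventions in the two halves. -/
theorem IsArcEnumeration.isBipartite_compl (h : IsArcEnumeration G n P) {i j : ℤ} (hij : i ≤ j)
    (hi : ∀ k, i ≤ k → k ≤ j → ClosedAdj G (P i) (P k))
    (hj : ∀ k, j ≤ k → k ≤ i + n → ClosedAdj G (P j) (P k)) : Gᶜ.IsBipartite := by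
  classical
  choose pos hpos1 hpos2 hpos using exists_position h.pos h.surj h.eq_iff i
  -- a vertex is turned back when some earlier vertex of its half is not its neighbour
  let B : ℤ → ℤ → Prop := fun a p => ∃ o, a ≤ o ∧ o < p ∧ ¬ ClosedAdj G (P p) (P o)
  let c : V → Bool := fun v =>
    if pos v < j then decide (B i (pos v)) else !decide (B j (pos v))
  have key : ∀ u v, pos u < pos v → ¬ ClosedAdj G u v → c u ≠ c v := by
    intro u v huv hadj
    have hu1 := hpos1 u
    have hv1 := hpos1 v
    have hv2 := hpos2 v
    have hadj' : ¬ ClosedAdj G (P (pos u)) (P (pos v)) := by rwa [hpos, hpos]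
    have hadj'' : ¬ ClosedAdj G (P (pos v)) (P (pos u)) := fun hc => hadj' hc.symm
    have hBi : pos u ≤ j → ¬ B i (pos u) := by
      rintro hu ⟨o, ho1, ho2, ho3⟩
      exact h.not_two_nonneighbors hi hu ho1 ho2 huv (by omega) ho3 hadj'
    have hBj : j ≤ pos v → (j ≤ pos u → ¬ B j (pos u)) ∧ (pos u < j → ¬ B j (pos v)) := by
      intro hv
      refine ⟨?_, ?_⟩
      · rintro hu ⟨o, ho1, ho2, ho3⟩
        exact h.not_two_nonneighbors hj (by omega) ho1 ho2 huv (by omega) ho3 hadj'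
      · rintro hu ⟨o, ho1, ho2, ho3⟩
        refine h.not_two_nonneighbors hj (by omega) ho1 ho2
          (q := pos u + n) (by omega) (by omega) ho3 ?_
        rwa [h.add]
    simp only [c]
    by_cases hu : pos u < j <;> by_cases hv : pos v < j
    · have : B i (pos v) := ⟨pos u, hu1, huv, hadj''⟩
      simp [hu, hv, this, hBi hu.le]
    · simp [hu, hv, hBi hu.le, (hBj (not_lt.1 hv)).2 hu]
    · omega
    · have : B j (pos v) := ⟨pos u, not_lt.1 hu, huv, hadj''⟩
      simp [hu, hv, this, (hBj (not_lt.1 hv)).1 (not_lt.1 hu)]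
  have : Gᶜ.Coloring Bool := SimpleGraph.Coloring.mk c (fun {u v} huv => by
    rw [SimpleGraph.compl_adj] at huv
    have hadj : ¬ ClosedAdj G u v := fun hc => hc.elim huv.1 huv.2
    rcases lt_trichotomy (pos u) (pos v) with hc | hc | hc
    · exact key u v hc hadj
    · exact absurd (by rw [← hpos u, ← hpos v, hc]) huv.1
    · exact (key v u hc fun hh => hadj hh.symm).symm)
  simpa using this.colorable

theorem IsArcEnumeration.neg (h : IsArcEnumeration G n P) :
    IsArcEnumeration G n fun i => P (-i) where
  pos := h.pos
  surj v := by
    obtain ⟨i, rfl⟩ := h.surj v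
    exact ⟨-i, by simp⟩
  eq_iff {i j} := by
    rw [h.eq_iff, ← dvd_neg]; ring_nf
  arc {i j} hij hji hadj := by
    have hadj' : ClosedAdj G (P (-i)) (P (-j + n)) := by rwa [h.add]
    rcases h.arc (by omega) (by omega) hadj' with h1 | h1
    · right
      intro k hk1 hk2
      rw [← h.add (-k)]
      exact h1 _ (by omega) (by omega)
    · left
      intro k hk1 hk2
      rw [← h.add (-k)]
      exact h1 _ (by omega) (by omega)

theorem IsArcEnumeration.isBipartite_compl' (h : IsArcEnumeration G n P) {i j : ℤ} (hij : i ≤ j)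
    (hi : ∀ k, i ≤ k → k ≤ j → ClosedAdj G (P j) (P k))
    (hj : ∀ k, j ≤ k → k ≤ i + n → ClosedAdj G (P i) (P k)) : Gᶜ.IsBipartite := by
  refine h.neg.isBipartite_compl (i := -j) (j := -i) (by omega) ?_ ?_
  · intro k hk1 hk2
    simpa using hi (-k) (by omega) (by omega)
  · intro k hk1 hk2
    rw [← h.add (-k)]
    simpa using hj (-k + n) (by omega) (by omega)

theorem IsArcEnumeration.isBipartite_of_two_cliques (h : IsArcEnumeration G n P) {i j : ℤ}
    (hi : ∀ a b, i ≤ a → a < b → b < j → ClosedAdj G (P a) (P b))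
    (hj : ∀ a b, j ≤ a → a < b → b < i + n → ClosedAdj G (P a) (P b)) : Gᶜ.IsBipartite := by
  classical
  choose pos hpos1 hpos2 hpos using exists_position h.pos h.surj h.eq_iff i
  have key : ∀ u v, pos u < pos v → ¬ ClosedAdj G u v →
      (decide (pos u < j)) ≠ decide (pos v < j) := by
    intro u v huv hadj
    have hadj' : ¬ ClosedAdj G (P (pos u)) (P (pos v)) := by rwa [hpos, hpos]
    by_cases hu : pos u < j <;> by_cases hv : pos v < j
    · exact absurd (hi _ _ (hpos1 u) huv hv) hadj'
    · simp [hu, hv]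
    · simp [hu, hv]
    · exact absurd (hj _ _ (not_lt.1 hu) huv (hpos2 v)) hadj'
  have : Gᶜ.Coloring Bool := SimpleGraph.Coloring.mk (fun v => decide (pos v < j))
    (fun {u v} huv => by
      rw [SimpleGraph.compl_adj] at huv
      have hadj : ¬ ClosedAdj G u v := fun hc => hc.elim huv.1 huv.2
      rcases lt_trichotomy (pos u) (pos v) with hc | hc | hc
      · exact key u v hc hadj
      · exact absurd (by rw [← hpos u, ← hpos v, hc]) huv.1
      · exact (key v u hc fun hh => hadj hh.symm).symm)
  simpa using this.colorable

/-- A vertex adjacent to all, an edge running both ways round, and two cliques covering the circle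
are each excluded, as they would make the complement bipartite. -/
theorem IsArcEnumeration.exists_isRound (h : IsArcEnumeration G n P) (hb : ¬ Gᶜ.IsBipartite) :
    ∃ g l, IsRound G n P g l := by
  classical
  have hn : 0 < n := h.pos
  have hn2 : 1 < n := by
    by_contra hc
    obtain rfl : n = 1 := by omega
    exact hb (h.isBipartite_of_two_cliques (i := 0) (j := 0) (by intros; omega)
      (by push_cast; intros; omega))
  have hex : ∀ i, ∃ t : ℕ, ¬ ClosedAdj G (P i) (P (i + t)) := by
    intro i
    by_contra! hc
    have hall : ∀ k, ClosedAdj G (P i) (P k) := by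
      intro k
      obtain ⟨j, hj1, -, hj⟩ := exists_position h.pos h.surj h.eq_iff i (P k)
      obtain ⟨t, rfl⟩ := Int.le.dest hj1
      rw [← hj]; exact hc t
    have h1 : ClosedAdj G (P (i + 1)) (P (i + n)) := by rw [h.add]; exact (hall _).symm
    rcases h.arc (by omega) (by omega) h1 with h2 | h2
    · exact hb (h.isBipartite_compl (i := i) (j := i + 1) (by omega)
        (fun k _ _ => hall k) fun k hk1 hk2 => h2 k hk1 hk2)
    · refine hb (h.isBipartite_compl' (i := i + 1) (j := i + n) (by omega)
        (fun k _ _ => ?_) fun k hk1 hk2 => h2 k hk1 hk2)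
      rw [h.add]; exact hall k
  let g : ℤ → ℤ := fun i => i + Nat.find (hex i)
  have hg : ∀ i, ¬ ClosedAdj G (P i) (P (g i)) := fun i => Nat.find_spec (hex i)
  have hgk : ∀ i k, i ≤ k → k < g i → ClosedAdj G (P i) (P k) := by
    intro i k hik hk
    obtain ⟨t, rfl⟩ := Int.le.dest hik
    exact not_not.1 (Nat.find_min (hex i) (by simp only [g] at hk; omega))
  have hgle : ∀ i j, (∀ k, i ≤ k → k ≤ j → ClosedAdj G (P i) (P k)) → j < g i := by
    intro i j hk
    by_contra hc
    exact hg i (hk _ (by simp only [g]; omega) (not_lt.1 hc))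
  have hlt : ∀ i, i < g i := fun i => hgle i i fun k h1 h2 => by
    rw [le_antisymm h1 h2]; exact .refl G _
  have hgn : ∀ i, g i < i + n := by
    intro i
    by_contra hc
    obtain ⟨j, hj1, hj2, hj⟩ := exists_position h.pos h.surj h.eq_iff i (P (g i))
    exact hg i (hj ▸ hgk i j hj1 (by omega))
  have hgadd : ∀ i, g (i + n) = g i + n := by
    intro i
    have : ∀ t : ℕ, P (i + n + t) = P (i + t) := fun t => by
      rw [← h.add (i + t)]; congr 1; ring
    simp only [g, h.add, this]; ring
  -- Otherwise `P j` is adjacent to all of the arc from `j` to `i + n`, which with the run from `i`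
  -- to `j` is the configuration of `isBipartite_compl`.
  have hback : ∀ i j, i < j → j < g i → ∀ k, i ≤ k → k ≤ j → ClosedAdj G (P j) (P k) := by
    intro i j hij hjg k hk1 hk2
    have := hgn i
    have h1 : ClosedAdj G (P j) (P (i + n)) := by
      rw [h.add]; exact (hgk i j hij.le hjg).symm
    rcases h.arc (by omega) (by omega) h1 with h2 | h2
    · exact absurd (h.isBipartite_compl hij.le
        (fun k h3 h4 => hgk i k h3 (by omega)) h2) hb
    · rw [← h.add k]; exact h2 _ (by omega) (by omega)
  have hmono1 : ∀ i j, i ≤ j → j < g i → g i ≤ g j := by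
    intro i j hij hjg
    have := hgle j (g i - 1) fun k hk1 hk2 => by
      rcases hij.lt_or_eq with hlt' | rfl
      · rcases hk1.lt_or_eq with hk | rfl
        · exact (hback i k (by omega) (by omega) j hij hk1).symm
        · exact .refl G _
      · exact hgk i k hk1 (by omega)
    omega
  have hmono : ∀ i j, i ≤ j → g i ≤ g j := by
    intro i j hij
    rcases lt_or_ge j (g i) with hc | hc
    · exact hmono1 i j hij hc
    · exact hc.trans (hlt j).le
  have hclique : ∀ i a b, i ≤ a → a < b → b < g i → ClosedAdj G (P a) (P b) := by
    intro i a b hia hab hbg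
    exact hgk a b hab.le (hbg.trans_le (hmono i a hia))
  have hgg : ∀ i, g (g i) < i + n := by
    intro i
    by_contra hc
    exact hb (h.isBipartite_of_two_cliques (i := i) (j := g i) (hclique i)
      fun a b h1 h2 h3 => hclique (g i) a b h1 h2 (by omega))
  have hl : ∀ i, ∃ m, i < g m ∧ ∀ j, i < g j → m ≤ j := fun i =>
    Int.exists_least_of_bdd ⟨i - n, fun z hz => by
      by_contra hc
      have h1 := hmono z (i - n) (by omega)
      have h2 := hgadd (i - n)
      rw [sub_add_cancel] at h2
      have := hgn i
      omega⟩ ⟨i, hlt i⟩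
  choose l hl1 hl2 using hl
  refine ⟨g, l, hn, h.surj, h.eq_iff, hgadd, fun {i j} => ⟨fun hij => (hl1 i).trans_le
    (hmono _ _ hij), hl2 i j⟩, hlt, hgg, fun {i j} hij hji => ⟨fun hadj => ?_, ?_⟩⟩
  · rcases h.arc hij hji hadj with h1 | h1
    · exact Or.inl (hgle i j h1)
    · right
      have h2 : ClosedAdj G (P j) (P (i + n)) := by rw [h.add]; exact hadj.symm
      rcases h.arc (by omega) (by omega) h2 with h3 | h3
      · exact hgle j _ h3
      · refine absurd (h.isBipartite_compl' hij.le (fun k hk1 hk2 => ?_) h1) hb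
        rw [← h.add k]; exact h3 _ (by omega) (by omega)
  · rintro (h1 | h1)
    · exact hgk i j hij.le h1
    · have := hgk j (i + n) (by omega) h1
      rw [h.add] at this
      exact this.symm

end ArcEnumeration

/-! ### Neighborhood windows `[l i, g i)`, twins and orientation -/

section Round

variable {V : Type*} {G : SimpleGraph V} {n : ℕ} {P : ℤ → V} {g l : ℤ → ℤ}

namespace IsRound

theorem P_add (h : IsRound G n P g l) (i : ℤ) : P (i + n) = P i :=
  h.eq_iff.2 ⟨-1, by ring⟩

theorem g_mono (h : IsRound G n P g l) {i j : ℤ} (hij : i ≤ j) : g i ≤ g j := by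
  have h1 : l (g i - 1) ≤ i := h.l_le_iff.2 (by omega)
  have h2 := h.l_le_iff.1 (h1.trans hij)
  omega

theorem l_le (h : IsRound G n P g l) (i : ℤ) : l i ≤ i := h.l_le_iff.2 (h.lt_g i)

theorem lt_g_l (h : IsRound G n P g l) (i : ℤ) : i < g (l i) := h.l_le_iff.1 le_rfl

theorem l_mono (h : IsRound G n P g l) {i j : ℤ} (hij : i ≤ j) : l i ≤ l j :=
  h.l_le_iff.2 (hij.trans_lt (h.lt_g_l j))

theorem l_add (h : IsRound G n P g l) (i : ℤ) : l (i + n) = l i + n := by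
  refine le_antisymm (h.l_le_iff.2 ?_) ?_
  · rw [h.g_add]; have := h.lt_g_l i; omega
  · have h1 := h.lt_g_l (i + n)
    have h2 := h.g_add (l (i + n) - n)
    rw [sub_add_cancel] at h2
    have := h.l_le_iff.2 (show i < g (l (i + n) - n) by omega)
    omega

theorem g_lt (h : IsRound G n P g l) (i : ℤ) : g i < i + n :=
  (h.lt_g _).trans (h.g_g_lt i)

theorem lt_l_add (h : IsRound G n P g l) (i : ℤ) : i < l i + n := by
  have := h.lt_g_l i
  have := h.g_lt (l i)
  omega

/-- Otherwise the run from `g i` would pass `i + n`, against `g_g_lt`. Thus the position `g i`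
carries a genuine non-neighbor. -/
theorem g_lt_l_add (h : IsRound G n P g l) (i : ℤ) : g i < l i + n := by
  by_contra hc
  have h1 := h.l_le_iff.1 (show l (i + n) ≤ g i by rw [h.l_add]; omega)
  have := h.g_g_lt i
  omega

theorem closedAdj (h : IsRound G n P g l) {i j : ℤ} (h1 : l i ≤ j) (h2 : j < g i) :
    ClosedAdj G (P i) (P j) := by
  have := h.g_lt i
  have := h.lt_l_add i
  rcases lt_trichotomy i j with hc | rfl | hc
  · exact (h.closedAdj_iff hc (by omega)).2 (Or.inl h2)
  · exact .refl G _
  · exact ((h.closedAdj_iff hc (by omega)).2 (Or.inl (h.l_le_iff.1 h1))).symm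

theorem not_closedAdj (h : IsRound G n P g l) {i j : ℤ} (h1 : g i ≤ j) (h2 : j < l i + n) :
    ¬ ClosedAdj G (P i) (P j) := by
  have := h.lt_g i
  have := h.l_le i
  rw [h.closedAdj_iff (by omega) (by omega)]
  have h3 : ¬ i + n < g j := fun hc => by
    have := h.l_le_iff.2 hc
    rw [h.l_add] at this
    omega
  omega

theorem exists_of_closedAdj (h : IsRound G n P g l) {i : ℤ} {w : V}
    (hw : ClosedAdj G (P i) w) : ∃ j, l i ≤ j ∧ j < g i ∧ P j = w := by
  obtain ⟨j, h1, h2, rfl⟩ := exists_position h.pos h.surj h.eq_iff (l i) w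
  exact ⟨j, h1, not_le.1 fun hc => h.not_closedAdj hc h2 hw, rfl⟩

theorem closedAdj_iff_exists (h : IsRound G n P g l) {i : ℤ} {w : V} :
    ClosedAdj G (P i) w ↔ ∃ j, l i ≤ j ∧ j < g i ∧ P j = w :=
  ⟨h.exists_of_closedAdj, fun ⟨_, h1, h2, hw⟩ => hw ▸ h.closedAdj h1 h2⟩

theorem twin_of_eq (h : IsRound G n P g l) {i j : ℤ} (hg : g i = g j) (hl : l i = l j) :
    Twin G (P i) (P j) := fun w => by
  rw [h.closedAdj_iff_exists, h.closedAdj_iff_exists, hg, hl]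

/-- If the windows differ at an end, the vertex at that end is a neighbor of one of the two only. -/
theorem eq_of_twin (h : IsRound G n P g l) {i m : ℤ} (him : i ≤ m) (hm : m < g i)
    (ht : Twin G (P i) (P m)) : g i = g m ∧ l i = l m := by
  have h1 := h.g_mono him
  have h2 := h.l_mono him
  have h3 := h.l_le m
  have h4 := h.g_lt_l_add i
  have h5 := h.g_lt_l_add m
  constructor
  · by_contra hne
    exact h.not_closedAdj le_rfl h4 ((ht _).2 (h.closedAdj (i := m) (by omega) (by omega)))
  · by_contra hne
    refine h.not_closedAdj (i := m) (j := l m - 1 + n) (by omega) (by omega) ?_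
    rw [h.P_add]
    exact (ht _).1 (h.closedAdj (by omega) (by omega))

theorem twin_of_between (h : IsRound G n P g l) {i j m : ℤ} (hij : i ≤ j) (hjm : j ≤ m)
    (hm : m < g i) (ht : Twin G (P i) (P m)) : Twin G (P j) (P i) := by
  obtain ⟨h1, h2⟩ := h.eq_of_twin (hij.trans hjm) hm ht
  have := h.g_mono hij
  have := h.g_mono hjm
  have := h.l_mono hij
  have := h.l_mono hjm
  exact h.twin_of_eq (by omega) (by omega)

/-- Reflection exchanges `g` and `l`; the offset `1` appears because windows include `l i` but
exclude `g i`. -/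
theorem neg (h : IsRound G n P g l) :
    IsRound G n (fun i => P (-i)) (fun i => 1 - l (-i)) (fun i => 1 - g (-i)) where
  pos := h.pos
  surj v := by
    obtain ⟨i, rfl⟩ := h.surj v
    exact ⟨-i, by simp⟩
  eq_iff {i j} := by
    rw [h.eq_iff, ← dvd_neg]; ring_nf
  g_add i := by
    have := h.l_add (-(i + n))
    rw [show -(i + (n : ℤ)) + n = -i by ring] at this
    omega
  l_le_iff {i j} := by
    have := h.l_le_iff (i := -j) (j := -i)
    omega
  lt_g i := by
    have := h.l_le (-i)
    omega
  g_g_lt i := by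
    have h1 := h.g_g_lt (-i + 1)
    have h2 : ¬ l (-i + n) ≤ g (-i + 1) := fun hc => by
      have := h.l_le_iff.1 hc
      omega
    rw [h.l_add] at h2
    have h3 : ¬ l (l (-i) - 1) ≤ -i + 1 - n := fun hc => by
      have h4 := h.l_le_iff.1 hc
      have h5 := h.g_add (-i + 1 - n)
      rw [sub_add_cancel] at h5
      omega
    rw [show -(1 - l (-i)) = l (-i) - 1 by ring]
    omega
  closedAdj_iff {i j} hij hji := by
    have h1 := h.closedAdj_iff (i := -j) (j := -i) (by omega) (by omega)
    have h2 := h.l_le_iff (i := -i) (j := -j)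
    have h3 := h.l_le_iff (i := -j) (j := -i - n)
    have h4 := h.g_add (-i - n)
    rw [sub_add_cancel] at h4
    rw [closedAdj_comm, h1]
    omega

theorem shift (h : IsRound G n P g l) (s : ℤ) :
    IsRound G n (fun i => P (i + s)) (fun i => g (i + s) - s) (fun i => l (i + s) - s) where
  pos := h.pos
  surj v := by
    obtain ⟨i, rfl⟩ := h.surj v
    exact ⟨i - s, by simp⟩
  eq_iff {i j} := by
    rw [h.eq_iff]; ring_nf
  g_add i := by
    have := h.g_add (i + s)
    rw [show i + n + s = i + s + (n : ℤ) by ring]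
    omega
  l_le_iff {i j} := by
    have := h.l_le_iff (i := i + s) (j := j + s)
    omega
  lt_g i := by
    have := h.lt_g (i + s)
    omega
  g_g_lt i := by
    have := h.g_g_lt (i + s)
    simp only [sub_add_cancel]
    omega
  closedAdj_iff {i j} hij hji := by
    rw [h.closedAdj_iff (by omega) (by omega)]
    omega

/-- A connected round graph has at most one gap. -/
theorem lt_g_pred (h : IsRound G n P g l) (hG : G.Connected) {a b : ℤ} (ha : g (a - 1) ≤ a)
    (hab : a < b) (hba : b < a + n) : b < g (b - 1) := by
  by_contra hc
  push Not at hc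
  let S : Set V := {v | ∃ i, a ≤ i ∧ i < b ∧ P i = v}
  have hgn : g (a + n - 1) ≤ a + n := by
    rw [show a + (n : ℤ) - 1 = a - 1 + n by ring, h.g_add]; omega
  have hsep : ∀ i j, a ≤ i → i < b → b ≤ j → j < a + n → ¬ ClosedAdj G (P i) (P j) := by
    intro i j h1 h2 h3 h4
    rw [h.closedAdj_iff (by omega) (by omega)]
    have := h.g_mono (show i ≤ b - 1 by omega)
    have := h.g_mono (show j ≤ a + n - 1 by omega)
    omega
  have hout : ∀ y, y ∉ S → ∃ j, b ≤ j ∧ j < a + n ∧ P j = y := by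
    intro y hy
    obtain ⟨j, h1, h2, rfl⟩ := exists_position h.pos h.surj h.eq_iff a y
    exact ⟨j, not_lt.1 fun hc => hy ⟨j, h1, hc, rfl⟩, h2, rfl⟩
  have hbS : P b ∉ S := by
    rintro ⟨i, h1, h2, h3⟩
    exact hsep i b h1 h2 le_rfl hba (h3 ▸ .refl G _)
  obtain ⟨x, ⟨i, h1, h2, rfl⟩, y, hy, hxy⟩ := exists_adj_of_connected hG S
    (a := P a) ⟨a, le_rfl, hab, rfl⟩ hbS
  obtain ⟨j, h3, h4, rfl⟩ := hout y hy
  exact hsep i j h1 h2 h3 h4 (Or.inr hxy)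

end IsRound

/-- The orientation of the edges given by a round enumeration. -/
def Fwd (P : ℤ → V) (g : ℤ → ℤ) (u v : V) : Prop :=
  ∃ i j, P i = u ∧ P j = v ∧ i < j ∧ j < g i

theorem fwd_neg_iff (h : IsRound G n P g l) {u v : V} :
    Fwd (fun i => P (-i)) (fun i => 1 - l (-i)) u v ↔ Fwd P g v u := by
  constructor
  · rintro ⟨i, j, rfl, rfl, h1, h2⟩
    exact ⟨-j, -i, rfl, rfl, by omega, h.l_le_iff.1 (by dsimp only at h2; omega)⟩
  · rintro ⟨i, j, rfl, rfl, h1, h2⟩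
    refine ⟨-j, -i, by simp, by simp, by omega, ?_⟩
    have := h.l_le_iff.2 h2
    simp only [neg_neg]
    omega

theorem fwd_shift_iff (s : ℤ) {u v : V} :
    Fwd (fun i => P (i + s)) (fun i => g (i + s) - s) u v ↔ Fwd P g u v := by
  constructor
  · rintro ⟨i, j, rfl, rfl, h1, h2⟩
    exact ⟨i + s, j + s, rfl, rfl, by omega, by dsimp only at h2; omega⟩
  · rintro ⟨i, j, rfl, rfl, h1, h2⟩
    exact ⟨i - s, j - s, by simp, by simp, by omega, by simp only [sub_add_cancel]; omega⟩

namespace IsRound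

theorem g_add_mul (h : IsRound G n P g l) (i k : ℤ) : g (i + n * k) = g i + n * k := by
  induction k using Int.induction_on with
  | zero => simp
  | succ k ih => rw [mul_add, mul_one, ← add_assoc, h.g_add, ih]; ring
  | pred k ih =>
    have := h.g_add (i + n * (-k - 1))
    rw [show i + n * (-k - 1) + (n : ℤ) = i + n * -k by ring, ih] at this
    linarith

theorem fwd_iff (h : IsRound G n P g l) {i j : ℤ} (hij : i < j) (hji : j < i + n) :
    Fwd P g (P i) (P j) ↔ j < g i := by
  refine ⟨?_, fun hj => ⟨i, j, rfl, rfl, hij, hj⟩⟩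
  rintro ⟨i', j', hi, hj, h1, h2⟩
  obtain ⟨a, ha⟩ := h.eq_iff.1 hi
  obtain ⟨b, hb⟩ := h.eq_iff.1 hj
  have h3 := h.g_lt i'
  have h4 := h.g_add_mul i' a
  have hn : (0 : ℤ) < n := by exact_mod_cast h.pos
  have hab : b = a := by
    rcases lt_trichotomy b a with hc | hc | hc
    · have : (n : ℤ) * (b + 1) ≤ n * a := mul_le_mul_of_nonneg_left hc hn.le
      rw [mul_add] at this
      omega
    · exact hc
    · have : (n : ℤ) * (a + 1) ≤ n * b := mul_le_mul_of_nonneg_left hc hn.le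
      rw [mul_add] at this
      omega
  subst hab
  obtain rfl : i = i' + n * b := by omega
  omega

theorem exists_lt_of_ne (h : IsRound G n P g l) {u v : V} (huv : u ≠ v) :
    ∃ i j : ℤ, i < j ∧ j < i + n ∧ P i = u ∧ P j = v := by
  obtain ⟨i, rfl⟩ := h.surj u
  obtain ⟨j, h1, h2, rfl⟩ := exists_position h.pos h.surj h.eq_iff i v
  exact ⟨i, j, lt_of_le_of_ne h1 fun hc => huv (hc ▸ rfl), h2, rfl, rfl⟩

/-- An edge running both ways would give `i + n < g j ≤ g (g i)`. -/
theorem fwd_iff_not (h : IsRound G n P g l) {u v : V} (huv : u ≠ v) (hadj : ClosedAdj G u v) :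
    Fwd P g u v ↔ ¬ Fwd P g v u := by
  obtain ⟨i, j, h1, h2, rfl, rfl⟩ := h.exists_lt_of_ne huv
  rw [h.fwd_iff h1 h2, ← h.P_add i, h.fwd_iff h2 (by omega)]
  have h3 := (h.closedAdj_iff h1 h2).1 hadj
  have h4 := h.g_g_lt i
  refine ⟨fun h5 h6 => ?_, fun h5 => by tauto⟩
  have := h.g_mono h5.le
  omega

theorem closedAdj_of_fwd (h : IsRound G n P g l) {u v : V} (huv : Fwd P g u v) :
    ClosedAdj G u v := by
  obtain ⟨i, j, rfl, rfl, h1, h2⟩ := huv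
  exact h.closedAdj ((h.l_le i).trans h1.le) h2

theorem fwd_of_twin (h : IsRound G n P g l) {a b v : V} (ht : Twin G a v) (hn : ¬ Twin G b a)
    (hf : Fwd P g b a) : Fwd P g b v := by
  obtain ⟨i, j, rfl, rfl, h1, h2⟩ := hf
  have hadj : ClosedAdj G (P i) v := by
    rw [← ht.closedAdj_right]; exact h.closedAdj ((h.l_le i).trans h1.le) h2
  obtain ⟨m, h3, h4, rfl⟩ := h.exists_of_closedAdj hadj
  rcases lt_trichotomy i m with hc | rfl | hc
  · exact ⟨i, m, rfl, rfl, hc, h4⟩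
  · exact absurd ht.symm hn
  -- Here `b`, at `i`, lies between the twins at `m` and `j`. If the run from `m` reaches `j`, then
  -- `b` is their twin; if not, `P (g m)` is adjacent to `P j` but not to `P m`.
  · exfalso
    have h5 := h.l_le_iff.1 h3
    rcases lt_or_ge j (g m) with h6 | h6
    · exact hn ((h.twin_of_between hc.le h1.le h6 ht.symm).trans ht.symm)
    · refine h.not_closedAdj le_rfl (h.g_lt_l_add m) ((ht _).1 (h.closedAdj ?_ ?_))
      · exact (h.l_le_iff.2 h2).trans h5.le
      · exact h6.trans_lt (h.lt_g j)

theorem fwd_twin_iff (h : IsRound G n P g l) {a b v : V} (ht : Twin G a v) (hn : ¬ Twin G b a) :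
    Fwd P g b a ↔ Fwd P g b v :=
  ⟨h.fwd_of_twin ht hn, h.fwd_of_twin ht.symm fun hc => hn (hc.trans ht.symm)⟩

theorem fwd_congr (h : IsRound G n P g l) {a b u v : V} (htb : Twin G b u) (hta : Twin G a v)
    (hn : ¬ Twin G b a) (hadj : ClosedAdj G b a) : Fwd P g b a ↔ Fwd P g u v := by
  have h1 : ¬ Twin G v b := fun hc => hn (hc.symm.trans hta.symm)
  have h2 : ¬ Twin G v u := fun hc => h1 (hc.trans htb.symm)
  have ne : ∀ {x y : V}, ¬ Twin G x y → x ≠ y := by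
    rintro x y hxy rfl; exact hxy (.refl G _)
  have hbv : ClosedAdj G b v := hta.closedAdj_right.1 hadj
  rw [h.fwd_twin_iff hta hn, h.fwd_iff_not (ne h1).symm hbv, h.fwd_twin_iff htb h1,
    ← h.fwd_iff_not (ne h2).symm ((htb v).1 hbv)]

end IsRound

end Round

/-! ### Colorings of the edges constant along induced paths -/

/-- A property of the edges which is shared by the two edges of each induced path with three
vertices and does not distinguish twins. -/
structure IsPathColoring {V : Type*} (G : SimpleGraph V) (col : V → V → Prop) : Prop where
  symm : ∀ {u v}, col u v → col v u
  path : ∀ {x b c}, ClosedAdj G x b → ClosedAdj G b c → ¬ ClosedAdj G x c →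
    (col x b ↔ col b c)
  twin : ∀ {a b v}, Twin G a v → ClosedAdj G b a → ¬ Twin G b a → (col b a ↔ col b v)

/-- The closed neighborhood of `b` is contained in that of `v`. -/
def Dominated {V : Type*} (G : SimpleGraph V) (b v : V) : Prop :=
  ∀ z, ClosedAdj G b z → ClosedAdj G v z

section Coloring

variable {V : Type*} {G : SimpleGraph V} {n : ℕ} {P : ℤ → V} {g l : ℤ → ℤ} {col : V → V → Prop}

namespace IsRound

/-- The vertices at `a` and `a + 1` both miss the one at `g (a + 1)`, a neighbor of `P b`; the two
induced paths through `P b` share their second edge. -/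
theorem col_first_of_lt (h : IsRound G n P g l) (hc : IsPathColoring G col) {a b : ℤ}
    (hla : l b ≤ a) (hab : a < b) (hgab : g a < g b) :
    col (P a) (P b) ↔ col (P (l b)) (P b) := by
  induction a, hla using Int.leInduction with
  | base => rfl
  | succ a hla ih =>
    have h1 : g a ≤ g (a + 1) := h.g_mono (by omega)
    rw [← ih (by omega) (by omega)]
    have h2 := h.g_g_lt (a + 1)
    have h3 := h.lt_g (a + 1)
    have hn : g (a + 1) < l a + n := by
      by_contra hcon
      have := h.l_le_iff.1 (show l (a + n) ≤ g (a + 1) by rw [h.l_add]; omega)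
      omega
    have hba : ∀ x, l b ≤ x → x < b → ClosedAdj G (P x) (P b) := fun x hx hxb =>
      (h.closedAdj hx (hxb.trans (h.lt_g b))).symm
    have hbc : ClosedAdj G (P b) (P (g (a + 1))) := h.closedAdj (by omega) hgab
    rw [hc.path (hba a hla (by omega)) hbc (h.not_closedAdj h1 hn),
      hc.path (hba (a + 1) (by omega) hab) hbc (h.not_closedAdj le_rfl (h.g_lt_l_add _))]

/-- A neighbor of `P b` which misses some neighbor of `P b` has the colour of the first
neighbor of `P b`. -/
theorem col_of_not_dominated (h : IsRound G n P g l) (hc : IsPathColoring G col) {b : ℤ} {w : V}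
    (hw : ClosedAdj G (P b) w) (hd : ¬ Dominated G (P b) w) :
    l b < b ∧ g (l b) < g b ∧ (col (P b) w ↔ col (P b) (P (l b))) := by
  have hs : ∀ u v, col u v ↔ col v u := fun u v => ⟨hc.symm, hc.symm⟩
  simp only [Dominated] at hd
  push Not at hd
  obtain ⟨z, hbz, hwz⟩ := hd
  -- Non-adjacent vertices in the window of `b` lie on opposite sides of `b`, since each side
  -- together with `b` is a clique.
  have key : ∀ x y, l b ≤ x → x < y → y < g b → ¬ ClosedAdj G (P x) (P y) →
      l b < b ∧ g (l b) < g b ∧ (col (P b) (P x) ↔ col (P b) (P (l b))) ∧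
        (col (P b) (P y) ↔ col (P b) (P (l b))) := by
    intro x y hx hxy hy hxy'
    have hyg : g x ≤ y := not_lt.1 fun hcon =>
      hxy' (h.closedAdj ((h.l_le x).trans hxy.le) hcon)
    have hxb : x < b := by
      by_contra hcon
      have := h.g_mono (not_lt.1 hcon)
      omega
    have hby : b < y := by
      by_contra hcon
      have := h.l_mono (not_lt.1 hcon)
      exact hxy' (h.closedAdj (by omega) (hxy.trans (h.lt_g y))).symm
    have h1 := h.col_first_of_lt hc hx hxb (by omega)
    have h2 := h.g_mono hx
    refine ⟨by omega, by omega, by rw [hs, h1, hs], ?_⟩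
    rw [← hc.path (h.closedAdj hx (by omega)).symm (h.closedAdj (by omega) hy) hxy', h1, hs]
  obtain ⟨x, hx1, hx2, rfl⟩ := h.exists_of_closedAdj hw
  obtain ⟨y, hy1, hy2, rfl⟩ := h.exists_of_closedAdj hbz
  rcases lt_trichotomy x y with hxy | rfl | hxy
  · obtain ⟨h1, h2, h3, -⟩ := key x y hx1 hxy hy2 hwz
    exact ⟨h1, h2, h3⟩
  · exact absurd (.refl G _) hwz
  · obtain ⟨h1, h2, -, h3⟩ := key y x hy1 hxy hx2 fun hcon => hwz hcon.symm
    exact ⟨h1, h2, h3⟩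

/-- The window of `v` must cover that of `b`. Failure of either conclusion puts a non-neighbor of `P
v` in the window of `b`: at `g v - n` or at `l b`. -/
theorem l_eq_of_dominated (h : IsRound G n P g l) {b v : ℤ} (hbv : b < v) (hvb : v < g b)
    (hd : Dominated G (P b) (P v)) : l v = l b ∧ g v < l b + n := by
  have h1 := h.l_mono hbv.le
  have h2 := h.g_g_lt b
  have h3 := h.g_mono hvb.le
  have h4 := h.g_lt_l_add v
  have h5 := h.g_mono hbv.le
  have h6 : g v < l b + n := by
    by_contra hcon
    refine h.not_closedAdj le_rfl h4 (hd _ ?_)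
    rw [← sub_add_cancel (g v) (n : ℤ), h.P_add]
    exact h.closedAdj (by omega) (by have := h.lt_g b; omega)
  refine ⟨le_antisymm ?_ h1, h6⟩
  by_contra hcon
  refine h.not_closedAdj (i := v) (j := l b + n) h6.le (by omega) (hd _ ?_)
  rw [h.P_add]
  exact h.closedAdj le_rfl (by have := h.l_le b; have := h.lt_g b; omega)

/-- `hA` is what remains when `P b` sees two colors. The first neighbor of `P b` is dominated by `P
v`, whose window starts at the same place, so no edge joins `l b - 1` to `l b`. By connectedness
this is the only gap, so `d = g v` is reached from some `p = l d < d`. With `a` the last neighbor of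
`b`, one has `b < v < a < p < d`, and the induced paths `b a p`, `a p d`, `v p d`, `b v p` carry the
color of `b a` to `b v`. -/
theorem false_of_dominated_right (h : IsRound G n P g l) (hG : G.Connected)
    (hc : IsPathColoring G col) {b v : ℤ} (hbv : b < v) (hvb : v < g b)
    (hd : Dominated G (P b) (P v)) (ht : ¬ Twin G (P b) (P v)) (hlb : l b < b)
    (hglb : g (l b) < g b)
    (hA : ∀ w, ClosedAdj G (P b) w → ¬ Dominated G (P b) w →
      Dominated G w (P v) ∧ ¬ (col (P b) w ↔ col (P b) (P v))) : False := by
  obtain ⟨hlv, hgv⟩ := h.l_eq_of_dominated hbv hvb hd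
  have hgbv : g b < g v := lt_of_le_of_ne (h.g_mono hbv.le) fun hcon =>
    ht (h.twin_of_eq hcon hlv.symm)
  have hbg : b < g (l b) := h.lt_g_l b
  -- the first neighbour of `b` is at a gap
  have hgap : g (l b - 1) ≤ l b := by
    have hD : Dominated G (P (l b)) (P v) := (hA _ (h.closedAdj le_rfl (by omega))
      fun hdom => h.not_closedAdj le_rfl (h.g_lt_l_add (l b))
        (hdom _ (h.closedAdj (by omega) hglb))).1
    by_contra hcon
    refine h.not_closedAdj (i := v) (j := l b - 1 + n) (by omega) (by omega) (hD _ ?_)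
    rw [h.P_add]
    exact h.closedAdj (h.l_le_iff.2 (by omega)) (by have := h.lt_g (l b); omega)
  have hgle : ∀ i, i < l b + n → g i ≤ l b + n := fun i hi => by
    have := h.g_mono (show i ≤ l b - 1 + n by omega)
    rw [h.g_add] at this
    omega
  have hvd := h.lt_g v
  have hconn := h.lt_g_pred hG hgap (b := g v) (by omega) hgv
  have hpd : l (g v) ≤ g v - 1 := h.l_le_iff.2 hconn
  have hdp := h.lt_g_l (g v)
  have hlt_p : ∀ x, g x ≤ g v → x < l (g v) := fun x hx => by
    by_contra hcon
    have := h.l_le_iff.1 (not_lt.1 hcon)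
    omega
  -- the last neighbour of `b`
  have ha := hA (P (g b - 1)) (h.closedAdj (by omega) (by omega)) fun hdom => by
    refine h.not_closedAdj (i := l b) (j := g b - 1) (by omega) ?_
      (hdom _ (h.closedAdj le_rfl (by omega))).symm
    by_contra hcon
    have := h.g_lt_l_add b
    have := h.l_le_iff.1 (show l (l b + n) ≤ g b - 1 by rw [h.l_add]; omega)
    have := hgle (g b - 1) (by omega)
    omega
  have hgad : g (g b - 1) ≤ g v := by
    by_contra hcon
    exact h.not_closedAdj le_rfl (by omega) (ha.1 _ (h.closedAdj (i := g b - 1)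
      ((h.l_le _).trans (by omega)) (not_le.1 hcon)))
  have hap := hlt_p _ hgad
  have hva : v ≠ g b - 1 := by
    rintro hva
    exact ha.2 (by rw [← hva])
  have hga := h.g_mono (show v ≤ g b - 1 by omega)
  set d := g v with hd_def
  set p := l d with hp_def
  set a := g b - 1 with ha_def
  have fw : ∀ x y, x < y → y < g x → ClosedAdj G (P x) (P y) := fun x y h1 h2 =>
    h.closedAdj ((h.l_le x).trans h1.le) h2
  have nfw : ∀ x y, b ≤ x → x < y → y < l b + n → g x ≤ y → ¬ ClosedAdj G (P x) (P y) :=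
    fun x y h1 h2 h3 h4 => h.not_closedAdj h4 (by have := h.l_mono h1; omega)
  have e1 := hc.path (fw b a (by omega) (by omega)) (fw a p (by omega) (by omega))
    (nfw b p le_rfl (by omega) (by omega) (by omega))
  have e2 := hc.path (fw a p (by omega) (by omega)) (fw p d (by omega) (by omega))
    (nfw a d (by omega) (by omega) (by omega) (by omega))
  have e3 := hc.path (fw v p (by omega) (by omega)) (fw p d (by omega) (by omega))
    (nfw v d (by omega) (by omega) (by omega) (by omega))
  have e4 := hc.path (fw b v (by omega) (by omega)) (fw v p (by omega) (by omega))
    (nfw b p le_rfl (by omega) (by omega) (by omega))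
  exact ha.2 (by rw [e1, e2, ← e3, ← e4])

/-- All edges from a vertex to non-twins have the same colour. -/
theorem col_iff_of_not_twin [Finite V] (h : IsRound G n P g l) (hG : G.Connected)
    (hc : IsPathColoring G col) {b x y : V} (hx : ClosedAdj G b x) (hy : ClosedAdj G b y)
    (hbx : ¬ Twin G b x) (hby : ¬ Twin G b y) : col b x ↔ col b y := by
  have hs : ∀ u v, col u v ↔ col v u := fun u v => ⟨hc.symm, hc.symm⟩
  -- A non-twin dominating `b` has fewer non-neighbors, so the induction hypothesis applies to it.
  induction hk : {z | ¬ ClosedAdj G b z}.ncard using Nat.strong_induction_on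
    generalizing b x y with
  | _ k ih =>
    subst hk
    have IH : ∀ v, Dominated G b v → ¬ Twin G b v → ∀ x y, ClosedAdj G v x → ClosedAdj G v y →
        ¬ Twin G v x → ¬ Twin G v y → (col v x ↔ col v y) := by
      intro v hv hbv x y hx hy hvx hvy
      refine ih _ ?_ hx hy hvx hvy rfl
      refine Set.ncard_lt_ncard ⟨fun z hz hbz => hz (hv z hbz), fun hsub => hbv fun z => ?_⟩
      exact ⟨hv z, fun hvz => by by_contra hbz; exact hsub hbz hvz⟩
    obtain ⟨i, rfl⟩ := h.surj b
    by_contra hne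
    -- one of the two is dominating
    obtain ⟨v, a, hv, ha, hva, hdv, hbv, hba⟩ : ∃ v a, ClosedAdj G (P i) v ∧
        ClosedAdj G (P i) a ∧ ¬ (col (P i) a ↔ col (P i) v) ∧ Dominated G (P i) v ∧
        ¬ Twin G (P i) v ∧ ¬ Twin G (P i) a := by
      by_cases h1 : Dominated G (P i) x
      · exact ⟨x, y, hx, hy, fun hcon => hne hcon.symm, h1, hbx, hby⟩
      by_cases h2 : Dominated G (P i) y
      · exact ⟨y, x, hy, hx, hne, h2, hby, hbx⟩
      · exact absurd ((h.col_of_not_dominated hc hx h1).2.2.trans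
          (h.col_of_not_dominated hc hy h2).2.2.symm) hne
    -- Edges at `v` have one color by induction, so `w` sees different colors towards `P i` and `v`.
    -- This forbids induction at `w`, so `w` does not dominate `P i`; and by `col_of_not_dominated`
    -- at `w`, one of `P i` and `v` dominates `w`, hence `v` does.
    have main : ∀ w, ClosedAdj G (P i) w → ¬ Twin G (P i) w →
        ¬ (col (P i) w ↔ col (P i) v) → ¬ Dominated G (P i) w ∧ Dominated G w v := by
      intro w hw hbw hwv
      have hvw : ClosedAdj G v w := hdv w hw
      have htw : ¬ Twin G v w := fun hcon => hwv (hc.twin hcon.symm hw hbw)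
      have e1 : col v w ↔ col v (P i) := IH v hdv hbv w (P i) hvw hv.symm htw fun hcon =>
        hbv hcon.symm
      have e2 : ¬ (col w (P i) ↔ col w v) := fun hcon => hwv (by
        rw [hs, hcon, hs, e1, hs])
      refine ⟨fun hdw => e2 (IH w hdw hbw _ _ hw.symm hvw.symm (fun hcon => hbw hcon.symm)
        fun hcon => htw hcon.symm), ?_⟩
      obtain ⟨j, rfl⟩ := h.surj w
      by_cases h1 : Dominated G (P j) v
      · exact h1
      · by_cases h2 : Dominated G (P j) (P i)
        · exact fun z hz => hdv z (h2 z hz)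
        · exact absurd ((h.col_of_not_dominated hc hw.symm h2).2.2.trans
            (h.col_of_not_dominated hc hvw.symm h1).2.2.symm) e2
    have hA : ∀ w, ClosedAdj G (P i) w → ¬ Dominated G (P i) w →
        Dominated G w v ∧ ¬ (col (P i) w ↔ col (P i) v) := by
      intro w hw hdw
      have e := (h.col_of_not_dominated hc hw hdw).2.2.trans
        (h.col_of_not_dominated hc ha (main a ha hba hva).1).2.2.symm
      have hwv : ¬ (col (P i) w ↔ col (P i) v) := fun hcon => hva (e.symm.trans hcon)
      exact ⟨(main w hw (fun hcon => hdw fun z hz => (hcon z).1 hz) hwv).2, hwv⟩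
    obtain ⟨j, hj1, hj2, rfl⟩ := h.exists_of_closedAdj hv
    have hda := (main a ha hba hva).1
    rcases lt_trichotomy i j with hij | rfl | hij
    · have h1 := h.col_of_not_dominated hc ha hda
      exact h.false_of_dominated_right hG hc hij hj2 hdv hbv h1.1 h1.2.1 hA
    · exact hbv (.refl G _)
    · have h1 := h.neg.col_of_not_dominated hc (b := -i) (w := a) (by simpa using ha)
        (by simpa using hda)
      exact h.neg.false_of_dominated_right hG hc (b := -i) (v := -j) (by omega)
        (by simp only [neg_neg]; omega) (by simpa using hdv) (by simpa using hbv) h1.1 h1.2.1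
        (by simpa using hA)

/-- All edges between non-twins have the same colour. -/
theorem col_iff_col [Finite V] (h : IsRound G n P g l) (hG : G.Connected)
    (hc : IsPathColoring G col) {u v u' v' : V} (huv : ClosedAdj G u v) (hn : ¬ Twin G u v)
    (huv' : ClosedAdj G u' v') (hn' : ¬ Twin G u' v') (hcol : col u v) : col u' v' := by
  have step : ∀ b b', G.Adj b b' → (∀ y, ClosedAdj G b y → ¬ Twin G b y → col b y) →
      ∀ y, ClosedAdj G b' y → ¬ Twin G b' y → col b' y := by
    intro b b' hbb' hb y hy hb'y
    by_cases ht : Twin G b b'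
    · have hby : ¬ Twin G b y := fun hcon => hb'y (ht.symm.trans hcon)
      have h1 := hb y ((ht y).2 hy) hby
      exact hc.symm ((hc.twin ht ((ht y).2 hy).symm fun hcon => hby hcon.symm).1 (hc.symm h1))
    · exact (h.col_iff_of_not_twin hG hc hy (Or.inr hbb'.symm) hb'y fun hcon => ht hcon.symm).2
        (hc.symm (hb b' (Or.inr hbb') ht))
  obtain ⟨p⟩ := hG.preconnected u u'
  have hwalk : ∀ {a c : V} (_ : G.Walk a c), (∀ y, ClosedAdj G a y → ¬ Twin G a y → col a y) →
      ∀ y, ClosedAdj G c y → ¬ Twin G c y → col c y := by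
    intro a c p
    induction p with
    | nil => exact id
    | cons hadj p ih => exact fun ha => ih (step _ _ hadj ha)
  exact hwalk p (fun y hy hny => (h.col_iff_of_not_twin hG hc huv hy hn hny).1 hcol) v' huv' hn'

end IsRound

end Coloring

/-! ### Uniqueness of arc representations -/

section ArcUniqueness

variable {V : Type*} {G : SimpleGraph V} {n : ℕ} {P P' : ℤ → V} {g l g' l' : ℤ → ℤ}

namespace IsRound

/-- Twins bound a run of twins on one side of the circle; the side through the cut would make the
vertices at `-1` and `0` twins. -/
theorem twin_of_between_of_boundary (h : IsRound G n P g l) (h0 : ¬ Twin G (P (-1)) (P 0))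
    {i j m : ℤ} (hi : 0 ≤ i) (hij : i ≤ j) (hjm : j ≤ m) (hm : m < n)
    (ht : Twin G (P i) (P m)) : Twin G (P j) (P i) := by
  rcases hij.lt_or_eq with hlt | rfl
  swap
  · exact .refl G _
  rcases (h.closedAdj_iff (hlt.trans_le hjm) (by omega)).1 ht.closedAdj with h1 | h1
  · exact h.twin_of_between hij hjm h1 ht
  · exfalso
    have ht' : Twin G (P m) (P (i + n)) := by rw [h.P_add]; exact ht.symm
    have h2 := h.twin_of_between (j := -1 + n) (by omega) (by omega) h1 ht'
    have h3 := h.twin_of_between (j := 0 + n) (by omega) (by omega) h1 ht'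
    rw [h.P_add] at h2 h3
    exact h0 (h2.trans h3.symm)

theorem bijective_fin (h : IsRound G n P g l) :
    Function.Bijective fun i : Fin n => P (i : ℕ) := by
  refine ⟨fun i j hij => ?_, fun v => ?_⟩
  · obtain ⟨k, hk⟩ := h.eq_iff.1 hij
    have := Int.eq_zero_of_abs_lt_dvd (m := n) (x := ((j : ℕ) : ℤ) - (i : ℕ)) ⟨k, hk⟩ (by
      rw [abs_lt]; omega)
    exact Fin.ext (by omega)
  · obtain ⟨k, h1, h2, hk⟩ := exists_position h.pos h.surj h.eq_iff 0 v
    exact ⟨⟨k.toNat, by omega⟩, by simp [h1, hk]⟩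

theorem exists_later_twin (h : IsRound G n P g l) (h' : IsRound G n P' g' l') {k : ℤ}
    (hk0 : 0 ≤ k) (hkn : k < n) (hag : ∀ i, 0 ≤ i → i < k → Twin G (P i) (P' i)) :
    ∃ q, k ≤ q ∧ q < n ∧ Twin G (P q) (P' k) := by
  obtain ⟨q, hq, hqt⟩ := exists_notMem_rel_of_agree (Twin G) Twin.symm Twin.trans (Twin.refl G)
    (Equiv.ofBijective _ h.bijective_fin) (Equiv.ofBijective _ h'.bijective_fin)
    {i : Fin n | ((i : ℕ) : ℤ) < k} (fun i hi => hag _ (by omega) hi)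
    (k := ⟨k.toNat, by omega⟩) (by simp [hk0])
  simp only [Equiv.ofBijective_apply, Int.toNat_of_nonneg hk0] at hqt
  exact ⟨(q : ℕ), not_lt.1 hq, by omega, hqt⟩

/-- Two round enumerations inducing the same orientation, cut at corresponding boundaries of twin
classes, coincide up to twins. -/
theorem twin_of_fwd_iff (h : IsRound G n P g l) (h' : IsRound G n P' g' l')
    (hD : ∀ u v, ClosedAdj G u v → ¬ Twin G u v → (Fwd P g u v ↔ Fwd P' g' u v))
    (h0 : ¬ Twin G (P (-1)) (P 0)) (h0' : ¬ Twin G (P' (-1)) (P' 0)) (h00 : Twin G (P 0) (P' 0))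
    (hgap : ∀ k : ℤ, 0 < k → k < n → k < g (k - 1)) (k : ℤ) (hk0 : 0 ≤ k) (hkn : k < n) :
    Twin G (P k) (P' k) := by
  induction hK : k.toNat using Nat.strong_induction_on generalizing k with
  | _ K ih =>
    subst hK
    by_contra hne
    have hag : ∀ i, 0 ≤ i → i < k → Twin G (P i) (P' i) := fun i h1 h2 =>
      ih i.toNat (by omega) i h1 (by omega) rfl
    have hk : 0 < k := lt_of_le_of_ne hk0 fun hc => hne (hc ▸ h00)
    obtain ⟨q, hkq, hqn, hq⟩ := h.exists_later_twin h' hk0 hkn hag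
    obtain ⟨q', hkq', hqn', hq'⟩ := h'.exists_later_twin h hk0 hkn fun i h1 h2 =>
      (hag i h1 h2).symm
    have hkq : k < q := lt_of_le_of_ne hkq fun hc => hne (hc ▸ hq)
    have hkq' : k < q' := lt_of_le_of_ne hkq' fun hc => hne (hc ▸ hq'.symm)
    have hu := hag (k - 1) (by omega) (by omega)
    have hn1 : ¬ Twin G (P (k - 1)) (P k) := fun hc => by
      have h1 := h'.twin_of_between_of_boundary h0' (i := k - 1) (by omega) (by omega) hkq'.le hqn'
        (hu.symm.trans (hc.trans hq'.symm))
      exact hne (hc.symm.trans (hu.trans h1.symm))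
    have hn2 : ¬ Twin G (P (k - 1)) (P' k) := fun hc => by
      have h1 := h.twin_of_between_of_boundary h0 (i := k - 1) (by omega) (by omega) hkq.le hqn
        (hc.trans hq.symm)
      exact hne (h1.trans hc)
    have hadj1 : Fwd P g (P (k - 1)) (P k) :=
      (h.fwd_iff (by omega) (by omega)).2 (hgap k hk hkn)
    -- transfer to the second enumeration and back
    have hq'g : q' < g' (k - 1) := by
      rw [← h'.fwd_iff (by omega) (by omega),
        ← h'.fwd_congr hu hq'.symm hn1 (h.closedAdj_of_fwd hadj1),
        ← hD _ _ (h.closedAdj_of_fwd hadj1) hn1]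
      exact hadj1
    have hqg : q < g (k - 1) := by
      have h1 : Fwd P' g' (P' (k - 1)) (P' k) :=
        (h'.fwd_iff (by omega) (by omega)).2 (by omega)
      have hn3 : ¬ Twin G (P' (k - 1)) (P' k) := fun hc => hn2 (hu.trans hc)
      have h2 := (hD _ _ (h'.closedAdj_of_fwd h1) hn3).2 h1
      rw [h.fwd_congr hu.symm hq.symm hn3 (h'.closedAdj_of_fwd h1)] at h2
      exact (h.fwd_iff (by omega) (by omega)).1 h2
    -- Transferred to `P`, this edge runs from `q` to `k + n`, so two runs starting at `k - 1` would
    -- make more than a full turn, against `g_g_lt`.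
    have h3 : Fwd P' g' (P' k) (P' q') := (h'.fwd_iff hkq' (by omega)).2
      (hq'g.trans_le (h'.g_mono (by omega)))
    have hn4 : ¬ Twin G (P' k) (P' q') := fun hc => hne (hq'.symm.trans hc.symm)
    have h4 := (hD _ _ (h'.closedAdj_of_fwd h3) hn4).2 h3
    rw [h.fwd_congr hq.symm hq' hn4 (h'.closedAdj_of_fwd h3), ← h.P_add k,
      h.fwd_iff (by omega) (by omega)] at h4
    have h5 := h.g_mono hqg.le
    have h6 := h.g_g_lt (k - 1)
    omega

theorem exists_boundary (h : IsRound G n P g l) (j : ℤ) :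
    ∃ i, Twin G (P i) (P j) ∧ ¬ Twin G (P (i - 1)) (P i) := by
  by_contra! hc
  have hall : ∀ t : ℕ, Twin G (P (j - t)) (P j) := by
    intro t
    induction t with
    | zero => simpa using Twin.refl G (P j)
    | succ t ih =>
      have := hc _ ih
      rw [show j - ((t + 1 : ℕ) : ℤ) = j - t - 1 by push_cast; ring]
      exact this.trans ih
  have h1 := h.l_le j
  have h2 := h.g_lt_l_add j
  obtain ⟨t, ht⟩ := Int.le.dest (show l j - 1 ≤ j by omega)
  refine h.not_closedAdj (i := j) (j := l j - 1 + n) (by omega) (by omega) ?_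
  rw [h.P_add, show l j - 1 = j - t by omega]
  exact (hall t).symm.closedAdj

/-- Two round enumerations inducing the same orientation coincide up to a rotation and twins. -/
theorem exists_shift_twin (h : IsRound G n P g l) (h' : IsRound G n P' g' l') (hG : G.Connected)
    (hD : ∀ u v, ClosedAdj G u v → ¬ Twin G u v → (Fwd P g u v ↔ Fwd P' g' u v)) :
    ∃ s : ℤ, ∀ k, Twin G (P k) (P' (k + s)) := by
  -- Cut at the only gap if there is one, otherwise at any boundary of a twin class: consecutive
  -- vertices are then adjacent away from the cut.
  obtain ⟨a, ha, hgap⟩ : ∃ a, ¬ Twin G (P (a - 1)) (P a) ∧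
      ∀ k : ℤ, 0 < k → k < n → k + a < g (k + a - 1) := by
    by_cases hex : ∃ a, g (a - 1) ≤ a
    · obtain ⟨a, ha⟩ := hex
      have h1 := h.lt_g_l (a - 1)
      have h2 := h.g_g_lt (a - 1)
      have h3 := h.lt_g (a - 1)
      have h4 := h.g_lt_l_add (a - 1)
      exact ⟨a, fun ht => h.not_closedAdj (i := a - 1) ha (by omega) ht.closedAdj,
        fun k h1 h2 => h.lt_g_pred hG ha (by omega) (by omega)⟩
    · push Not at hex
      obtain ⟨a, -, ha⟩ := h.exists_boundary 0
      exact ⟨a, ha, fun k _ _ => hex _⟩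
  obtain ⟨j, hj⟩ := h'.surj (P a)
  obtain ⟨b, hb, hb'⟩ := h'.exists_boundary j
  rw [hj] at hb
  have key := (h.shift a).twin_of_fwd_iff (h'.shift b)
    (fun u v h1 h2 => by rw [fwd_shift_iff, fwd_shift_iff, hD u v h1 h2])
    (by simpa [neg_add_eq_sub] using ha) (by simpa [neg_add_eq_sub] using hb')
    (by simpa using hb.symm) (fun k h1 h2 => by
      have := hgap k h1 h2
      rw [show k - 1 + a = k + a - 1 by ring]
      omega)
  refine ⟨b - a, fun k => ?_⟩
  obtain ⟨i, h1, h2, h3⟩ := exists_position h.pos h.surj h.eq_iff a (P k)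
  have h4 : P' (i + (b - a)) = P' (k + (b - a)) := by
    rw [h'.eq_iff]
    simpa using h.eq_iff.1 h3
  have h5 := key (i - a) (by omega) (by omega)
  simp only [sub_add_cancel] at h5
  rw [← h3, ← h4]
  convert h5 using 2
  ring

/-- Two neighbors of `b` on the same side of it would be adjacent, so one edge enters `b` and the
other leaves it. -/
theorem fwd_path_iff (h : IsRound G n P g l) {x b c : V} (hxb : ClosedAdj G x b)
    (hbc : ClosedAdj G b c) (hxc : ¬ ClosedAdj G x c) : Fwd P g x b ↔ Fwd P g b c := by
  obtain ⟨j, rfl⟩ := h.surj b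
  obtain ⟨i, hi1, hi2, rfl⟩ := h.exists_of_closedAdj hxb.symm
  obtain ⟨k, hk1, hk2, rfl⟩ := h.exists_of_closedAdj hbc
  have hij : i ≠ j := by rintro rfl; exact hxc hbc
  have hkj : k ≠ j := by rintro rfl; exact hxc hxb
  have h1 := h.g_lt j
  have h2 := h.lt_l_add j
  have h3 := h.g_lt_l_add j
  have fw : ∀ {x y : ℤ}, x ≤ y → y < g x → ClosedAdj G (P x) (P y) := fun h1 h2 =>
    h.closedAdj ((h.l_le _).trans h1) h2
  have hfx : Fwd P g (P i) (P j) ↔ i < j := by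
    rcases lt_or_gt_of_ne hij with hc | hc
    · rw [h.fwd_iff hc (by omega)]
      simp only [hc, iff_true]
      exact h.l_le_iff.1 hi1
    · have hne : P i ≠ P j := by rintro he; exact hxc (he ▸ hbc)
      rw [h.fwd_iff_not hne hxb, h.fwd_iff hc (by omega)]
      omega
  have hfc : Fwd P g (P j) (P k) ↔ j < k := by
    rcases lt_or_gt_of_ne hkj with hc | hc
    · have hne : P j ≠ P k := by rintro he; exact hxc (he ▸ hxb)
      rw [h.fwd_iff_not hne hbc, h.fwd_iff hc (by omega)]
      have := h.l_le_iff.1 hk1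
      omega
    · rw [h.fwd_iff hc (by omega)]
      omega
  rw [hfx, hfc]
  have e1 := h.l_le_iff.1 hi1
  have e2 := h.l_le_iff.1 hk1
  constructor
  · intro hc
    by_contra hc'
    rcases le_total i k with hik | hik
    · exact hxc (fw hik (by omega))
    · exact hxc (fw hik (by omega)).symm
  · intro hc
    by_contra hc'
    rcases le_total i k with hik | hik
    · exact hxc (fw hik (by have := h.g_mono (show j ≤ i by omega); omega))
    · exact hxc (fw hik (by have := h.g_mono (show j ≤ k by omega); omega)).symm

/-- The edges on which two round enumerations induce the same orientation. -/
theorem isPathColoring (h : IsRound G n P g l) (h' : IsRound G n P' g' l') :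
    IsPathColoring G fun u v =>
      (Fwd P g u v ∧ Fwd P' g' u v) ∨ (Fwd P g v u ∧ Fwd P' g' v u) where
  symm := Or.symm
  path hxb hbc hxc := by
    rw [h.fwd_path_iff hxb hbc hxc, h'.fwd_path_iff hxb hbc hxc,
      h.fwd_path_iff hbc.symm hxb.symm fun hc => hxc hc.symm,
      h'.fwd_path_iff hbc.symm hxb.symm fun hc => hxc hc.symm]
  twin {a b v} ht hadj hn := by
    have hn' : ¬ Twin G a b := fun hc => hn hc.symm
    rw [h.fwd_twin_iff ht hn, h'.fwd_twin_iff ht hn, h.fwd_congr ht (.refl G b) hn' hadj.symm,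
      h'.fwd_congr ht (.refl G b) hn' hadj.symm]

/-- Two round enumerations of a connected graph coincide up to a symmetry of the circle and
twins. -/
theorem exists_symmetry_twin [Finite V] (h : IsRound G n P g l) (h' : IsRound G n P' g' l')
    (hG : G.Connected) :
    ∃ s : ℤ, (∀ k, Twin G (P k) (P' (k + s))) ∨ ∀ k, Twin G (P k) (P' (-(k + s))) := by
  have hc := h.isPathColoring h'
  have ne : ∀ {x y : V}, ¬ Twin G x y → x ≠ y := by
    rintro x y hxy rfl; exact hxy (.refl G _)
  by_cases hall : ∀ u v, ClosedAdj G u v → ¬ Twin G u v →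
      (Fwd P g u v ∧ Fwd P' g' u v) ∨ (Fwd P g v u ∧ Fwd P' g' v u)
  · obtain ⟨s, hs⟩ := h.exists_shift_twin h' hG fun u v hadj hn => by
      have := hall u v hadj hn
      have := h.fwd_iff_not (ne hn) hadj
      have := h'.fwd_iff_not (ne hn) hadj
      tauto
    exact ⟨s, Or.inl hs⟩
  · push Not at hall
    obtain ⟨u₀, v₀, hadj₀, hn₀, hcol⟩ := hall
    -- One edge oriented differently forces, by `col_iff_col`, all edges between non-twins to be;
    -- reflecting `P'` makes the orientations agree.
    obtain ⟨s, hs⟩ := h.exists_shift_twin h'.neg hG fun u v hadj hn => by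
      rw [fwd_neg_iff h']
      have h1 := mt (h.col_iff_col hG hc hadj hn hadj₀ hn₀) (by tauto)
      have := h.fwd_iff_not (ne hn) hadj
      have := h'.fwd_iff_not (ne hn) hadj
      tauto
    exact ⟨s, Or.inr hs⟩

end IsRound

theorem arcEquivalent_of_isArcRepresentation [Finite V] (hG : G.Connected)
    (hb : ¬ Gᶜ.IsBipartite) {lam lam' : V ≃ ZMod n}
    (h : IsArcRepresentation (closedNeighborhoodHypergraph G) lam)
    (h' : IsArcRepresentation (closedNeighborhoodHypergraph G) lam') :
    ArcEquivalent (closedNeighborhoodHypergraph G) lam lam' := by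
  obtain ⟨g, l, hr⟩ := h.isArcEnumeration.exists_isRound hb
  obtain ⟨g', l', hr'⟩ := h'.isArcEnumeration.exists_isRound hb
  have fin : ∀ σ : Equiv.Perm (ZMod n), (∀ k : ℤ, Twin G (lam.symm k) (lam'.symm (σ k))) →
      ∃ π : Equiv.Perm V, IsTwinPermutation (closedNeighborhoodHypergraph G) π ∧
        ∀ v, lam' v = σ (lam (π v)) := by
    intro σ hσ
    refine ⟨(lam'.trans σ.symm).trans lam.symm, isTwinPermutation_of_forall_twin _ fun v => ?_,
      fun v => by simp⟩
    have : NeZero n := ⟨h.1⟩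
    simpa using hσ (σ.symm (lam' v)).val
  obtain ⟨s, hs | hs⟩ := hr.exists_symmetry_twin hr' hG
  · obtain ⟨π, hπ, hv⟩ := fin (Equiv.addRight (s : ZMod n)) fun k => by simpa using hs k
    exact ⟨_, π, ⟨s, Or.inl fun x => rfl⟩, hπ, hv⟩
  · obtain ⟨π, hπ, hv⟩ := fin ((Equiv.neg _).trans (Equiv.addRight (-s : ZMod n))) fun k => by
      have := hs k
      push_cast at this
      rw [neg_add] at this
      simpa using this
    exact ⟨_, π, ⟨-s, Or.inr fun x => rfl⟩, hπ, hv⟩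

end ArcUniqueness

theorem mainTheorem10 {V : Type*} [Fintype V] (G : SimpleGraph V) (hG : G.Connected) :
    (IsProperIntervalGraph G →
      (∃ lam : V ≃ Fin (Fintype.card V),
        IsIntervalRepresentation (closedNeighborhoodHypergraph G) lam) ∧
      ∀ lam lam' : V ≃ Fin (Fintype.card V),
        IsIntervalRepresentation (closedNeighborhoodHypergraph G) lam →
        IsIntervalRepresentation (closedNeighborhoodHypergraph G) lam' →
        IntervalEquivalent (closedNeighborhoodHypergraph G) lam lam') ∧
    (IsProperCircularArcGraph G → ¬ Gᶜ.IsBipartite →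
      (∃ lam : V ≃ ZMod (Fintype.card V),
        IsArcRepresentation (closedNeighborhoodHypergraph G) lam) ∧
      ∀ lam lam' : V ≃ ZMod (Fintype.card V),
        IsArcRepresentation (closedNeighborhoodHypergraph G) lam →
        IsArcRepresentation (closedNeighborhoodHypergraph G) lam' →
        ArcEquivalent (closedNeighborhoodHypergraph G) lam lam') :=
  ⟨fun h => ⟨h.exists_isIntervalRepresentation, fun _ _ h1 h2 =>
      intervalEquivalent_of_isUmbrella hG h1.isUmbrella h2.isUmbrella⟩,
    fun h hb => ⟨h.exists_isArcRepresentation hb, fun _ _ h1 h2 =>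
      arcEquivalent_of_isArcRepresentation hG hb h1 h2⟩⟩
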